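/- Let $q,r$ be complex-valued functions in the Schwartz class $\mathcal S(\mathbb R)$. For $\zeta\in\mathbb C$ consider the linear system $$\frac{d}{dx}\begin{bmatrix}\alpha\\ \beta\end{bmatrix}=\begin{bmatrix}-i\zeta^2-\frac i2 q(x)r(x)&\zeta q(x)\\ \zeta r(x)&i\zeta^2+\frac i2 q(x)r(x)\end{bmatrix}\begin{bmatrix}\alpha\\ \beta\end{bmatrix},\qquad x\in\mathbb R.$$ The Jost solutions $\psi,\bar\psi,\phi,\bar\phi$ (the bar does not denote complex conjugation; the subscripts $1,2$ denote the components) are the solutions on $\mathbb R$ with the asymptotics $$\begin{aligned}&\psi_1(\zeta,x)=o(1),\quad \psi_2(\zeta,x)=e^{i\zeta^2x}[1+o(1)],&&x\to+\infty,\\ &\bar\psi_1(\zeta,x)=e^{-i\zeta^2x}[1+o(1)],\quad \bar\psi_2(\zeta,x)=o(1),&&x\to+\infty,\\ &\phi_1(\zeta,x)=e^{-i\zeta^2x}[1+o(1)],\quad \phi_2(\zeta,x)=o(1),&&x\to-\infty,\\ &\bar\phi_1(\zeta,x)=o(1),\quad \bar\phi_2(\zeta,x)=e^{i\zeta^2x}[1+o(1)],&&x\to-\infty.\end{aligned}$$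 Let $Q_{13}$ be the union of the open first and third quadrants of the complex $\zeta$-plane, $Q_{24}$ the union of the open second and fourth quadrants, and $\overline{Q_{13}}$, $\overline{Q_{24}}$ their closures; let $\mathbb C^\pm$ be the open upper and lower half-planes and $\lambda=\zeta^2$. Then: (a) The solutions $\psi(\zeta,\cdot)$ and $\phi(\zeta,\cdot)$ exist and are unique for every $\zeta\in\overline{Q_{13}}$, and for each fixed $x\in\mathbb R$ the functions $\psi(\zeta,x)$ and $\phi(\zeta,x)$ are analytic in $\zeta\in Q_{13}$ and continuous in $\zeta\in\overline{Q_{13}}$. The solutions $\bar\psi(\zeta,\cdot)$ and $\bar\phi(\zeta,\cdot)$ exist and are unique for every $\zeta\in\overline{Q_{24}}$, and for each fixed $x\in\mathbb R$ the functions $\bar\psi(\zeta,x)$ and $\bar\phi(\zeta,x)$ are analytic in $\zeta\in Q_{24}$ and continuous in $\zeta\in\overline{Q_{24}}$. (b) For each fixed $x\in\mathbb R$, the components $\psi_1(\zeta,x)$, $\phi_2(\zeta,x)$ (on $\overline{Q_{13}}$) and $\bar\psi_2(\zeta,x)$, $\bar\phi_1(\zeta,x)$ (on $\overline{Q_{24}}$)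 are odd in $\zeta$, and the components $\psi_2(\zeta,x)$, $\phi_1(\zeta,x)$ (on $\overline{Q_{13}}$) and $\bar\psi_1(\zeta,x)$, $\bar\phi_2(\zeta,x)$ (on $\overline{Q_{24}}$) are even in $\zeta$. (c) For each fixed $x\in\mathbb R$, the quantities $\psi_1(\zeta,x)/\zeta$ and $\phi_2(\zeta,x)/\zeta$ (for $\zeta\in\overline{Q_{13}}\setminus\{0\}$) and $\psi_2(\zeta,x)$ and $\phi_1(\zeta,x)$ (for $\zeta\in\overline{Q_{13}}$) are even in $\zeta$ and are functions of $\lambda$ that are analytic in $\mathbb C^+$ and continuous in $\overline{\mathbb C^+}$ (the two quotients extend continuously to $\lambda=0$). (d) For each fixed $x\in\mathbb R$, the quantities $\bar\psi_2(\zeta,x)/\zeta$ and $\bar\phi_1(\zeta,x)/\zeta$ (for $\zeta\in\overline{Q_{24}}\setminus\{0\}$) and $\bar\psi_1(\zeta,x)$ and $\bar\phi_2(\zeta,x)$ (for $\zeta\in\overline{Q_{24}}$) are even in $\zeta$ and are functions of $\lambda$ that are analytic in $\mathbb C^-$ and continuous in $\overline{\mathbb C^-}$ (the two quotients extend continuously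 to $\lambda=0$). -/

import Mathlib

open Set Filter Topology Asymptotics
open scoped Matrix SchwartzMap

/-- The coefficient matrix of the energy-dependent linear system with potentials `q`, `r`. -/
noncomputable def systemMatrix (q r : ℝ → ℂ) (ζ : ℂ) (x : ℝ) : Matrix (Fin 2) (Fin 2) ℂ :=
  !![-(Complex.I * ζ ^ 2) - Complex.I / 2 * (q x * r x), ζ * q x;
    ζ * r x, Complex.I * ζ ^ 2 + Complex.I / 2 * (q x * r x)]

/-- `f = (α, β)` is a solution, on the whole real line, of the linear system at the
spectral parameter `ζ`. -/
def IsSolution (q r : ℝ → ℂ) (ζ : ℂ) (f : ℝ → Fin 2 → ℂ) : Prop :=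
  ∀ x : ℝ, HasDerivAt f (systemMatrix q r ζ x *ᵥ f x) x

/-- The Jost solution `ψ(ζ, ·)`: `ψ₁ = o(1)`, `ψ₂ = e^{iζ²x}[1 + o(1)]` as `x → +∞`. -/
structure IsJostPsi (q r : ℝ → ℂ) (ζ : ℂ) (f : ℝ → Fin 2 → ℂ) : Prop where
  sol : IsSolution q r ζ f
  fst : (fun x => f x 0) =o[atTop] (fun _ : ℝ => (1 : ℂ))
  snd : (fun x => f x 1) ~[atTop] (fun x : ℝ => Complex.exp (Complex.I * ζ ^ 2 * x))

/-- The Jost solution `ψ̄(ζ, ·)`: `ψ̄₁ = e^{-iζ²x}[1 + o(1)]`, `ψ̄₂ = o(1)` as `x → +∞`. -/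
structure IsJostPsiBar (q r : ℝ → ℂ) (ζ : ℂ) (f : ℝ → Fin 2 → ℂ) : Prop where
  sol : IsSolution q r ζ f
  fst : (fun x => f x 0) ~[atTop] (fun x : ℝ => Complex.exp (-(Complex.I * ζ ^ 2 * x)))
  snd : (fun x => f x 1) =o[atTop] (fun _ : ℝ => (1 : ℂ))

/-- The Jost solution `φ(ζ, ·)`: `φ₁ = e^{-iζ²x}[1 + o(1)]`, `φ₂ = o(1)` as `x → -∞`. -/
structure IsJostPhi (q r : ℝ → ℂ) (ζ : ℂ) (f : ℝ → Fin 2 → ℂ) : Prop where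
  sol : IsSolution q r ζ f
  fst : (fun x => f x 0) ~[atBot] (fun x : ℝ => Complex.exp (-(Complex.I * ζ ^ 2 * x)))
  snd : (fun x => f x 1) =o[atBot] (fun _ : ℝ => (1 : ℂ))

/-- The Jost solution `φ̄(ζ, ·)`: `φ̄₁ = o(1)`, `φ̄₂ = e^{iζ²x}[1 + o(1)]` as `x → -∞`. -/
structure IsJostPhiBar (q r : ℝ → ℂ) (ζ : ℂ) (f : ℝ → Fin 2 → ℂ) : Prop where
  sol : IsSolution q r ζ f
  fst : (fun x => f x 0) =o[atBot] (fun _ : ℝ => (1 : ℂ))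
  snd : (fun x => f x 1) ~[atBot] (fun x : ℝ => Complex.exp (Complex.I * ζ ^ 2 * x))

/-- The union of the open first and third quadrants. -/
def quadrants13 : Set ℂ := {ζ | 0 < ζ.re ∧ 0 < ζ.im} ∪ {ζ | ζ.re < 0 ∧ ζ.im < 0}

/-- The union of the open second and fourth quadrants. -/
def quadrants24 : Set ℂ := {ζ | ζ.re < 0 ∧ 0 < ζ.im} ∪ {ζ | 0 < ζ.re ∧ ζ.im < 0}

/-- The open upper half-plane `ℂ⁺`. -/
def upperPlane : Set ℂ := {z | 0 < z.im}

/-- The open lower half-plane `ℂ⁻`. -/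
def lowerPlane : Set ℂ := {z | z.im < 0}

/-- `g` is odd on `S`. -/
def OddIn (S : Set ℂ) (g : ℂ → ℂ) : Prop := ∀ ζ ∈ S, g (-ζ) = -g ζ

/-- `g` is even on `S`. -/
def EvenIn (S : Set ℂ) (g : ℂ → ℂ) : Prop := ∀ ζ ∈ S, g (-ζ) = g ζ

/-- On `S`, the quantity `g(ζ)` is even and is a function of `λ = ζ²`; that function of `λ` is
analytic in `H` and continuous in the closure of `H`. -/
def AnalyticInSquare (S H : Set ℂ) (g : ℂ → ℂ) : Prop :=
  EvenIn S g ∧ ∃ F : ℂ → ℂ, (∀ ζ ∈ S, g ζ = F (ζ ^ 2)) ∧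
    AnalyticOnNhd ℂ F H ∧ ContinuousOn F (closure H)

/-! Put `λ = ζ²` and write `ψ = e^{iλx} (ζ u, v)`. The system becomes `u' = -2iλ u + a u + q v`, `v'
= -a v + λ r u` with `a = -(i/2) q r`, so `ζ` enters only through `λ`. Parity and dependence on `λ`
alone are then built into the form `(ζ A(λ), B(λ))`, and it remains to study `u` and `v`.

With `u → 0`, `v → 1` at `+∞` these are Volterra equations whose kernels `e^{2iλ(y-x)}` and `1`, for
`y > x`, are bounded by `1` when `Im λ ≥ 0`. In a suitable exponential weight each iteration gains a
factor `1/2` (`integral_mul_volterraWeight`, `norm_jostIter_le`), so the Neumann series converges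
locally uniformly in `λ` and inherits continuity on the closed half-plane and holomorphy inside
(`continuousOn_jost`, `analyticOnNhd_jost`).

Uniqueness follows from the constancy of the Wronskian (`IsJostPsi.unique`). The other three
solutions reduce to `ψ` for transformed potentials, by exchanging components with `ζ ↦ -iζ` and by
reflecting `x ↦ -x` (`isJostPsiBar_iff`, `isJostPhi_iff`, `isJostPhiBar_iff`). -/

open MeasureTheory

/-! ### Holomorphic dependence of integrals on a parameter. -/

/-- An integral of holomorphic functions with an integrable majorant is holomorphic. -/
theorem differentiableOn_integral_of_dominated {α : Type*} [MeasurableSpace α] {m : Measure α}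
    {U : Set ℂ} (hU : IsOpen U) {F : ℂ → α → ℂ} {h : α → ℝ}
    (hmeas : ∀ z ∈ U, AEStronglyMeasurable (F z) m)
    (hbound : ∀ᵐ a ∂m, ∀ z ∈ U, ‖F z a‖ ≤ h a) (hint : Integrable h m)
    (hdiff : ∀ᵐ a ∂m, DifferentiableOn ℂ (fun z => F z a) U) :
    DifferentiableOn ℂ (fun z => ∫ a, F z a ∂m) U := by
  intro z₀ hz₀
  obtain ⟨ε, hε, hball⟩ := Metric.isOpen_iff.1 hU z₀ hz₀
  have hsub : ∀ z ∈ Metric.ball z₀ (ε / 2), Metric.closedBall z (ε / 4) ⊆ U := by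
    intro z hz w hw
    apply hball
    rw [Metric.mem_ball] at hz ⊢
    rw [Metric.mem_closedBall] at hw
    linarith [dist_triangle w z z₀]
  have hmem : ∀ z ∈ Metric.ball z₀ (ε / 2), z ∈ U := fun z hz =>
    hsub z hz (Metric.mem_closedBall_self (by positivity))
  have hderiv : ∀ᵐ a ∂m, ∀ z ∈ Metric.ball z₀ (ε / 2),
      HasDerivAt (fun z => F z a) (deriv (fun z => F z a) z) z := by
    filter_upwards [hdiff] with a ha z hz
    exact (ha.differentiableAt (hU.mem_nhds (hmem z hz))).hasDerivAt
  -- The derivative is an a.e. limit of measurable difference quotients, along nonzero steps `δ n →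
  -- 0` that stay in the ball around `z₀`.
  have hmeas' : AEStronglyMeasurable (fun a => deriv (fun z => F z a) z₀) m := by
    let δ : ℕ → ℂ := fun n => ((ε / 2 * (1 / ((n : ℝ) + 2)) : ℝ) : ℂ)
    have hδpos : ∀ n : ℕ, 0 < ε / 2 * (1 / ((n : ℝ) + 2)) := fun n => by positivity
    have hδU : ∀ n, z₀ + δ n ∈ U := by
      intro n
      apply hball
      rw [Metric.mem_ball, dist_eq_norm, add_sub_cancel_left, Complex.norm_real,
        Real.norm_of_nonneg (hδpos n).le]
      have : 1 / ((n : ℝ) + 2) ≤ 1 := by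
        rw [div_le_one (by positivity)]
        linarith [(Nat.cast_nonneg n : (0 : ℝ) ≤ n)]
      nlinarith
    have hδ0 : Tendsto δ atTop (𝓝[≠] 0) := by
      refine tendsto_nhdsWithin_iff.2 ⟨?_, Eventually.of_forall fun n => ?_⟩
      · have h1 : Tendsto (fun n : ℕ => ε / 2 * (1 / ((n : ℝ) + 2))) atTop (𝓝 (ε / 2 * 0)) := by
          refine Tendsto.const_mul _ ?_
          simp only [one_div]
          exact tendsto_inv_atTop_zero.comp
            (tendsto_atTop_add_const_right _ _ tendsto_natCast_atTop_atTop)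
        have h2 := (Complex.continuous_ofReal.tendsto _).comp h1
        rwa [mul_zero, Complex.ofReal_zero] at h2
      · exact Complex.ofReal_ne_zero.2 (hδpos n).ne'
    refine aestronglyMeasurable_of_tendsto_ae atTop
      (f := fun n a => (δ n)⁻¹ • (F (z₀ + δ n) a - F z₀ a)) (fun n => ?_) ?_
    · exact ((hmeas _ (hδU n)).sub (hmeas _ hz₀)).const_smul (δ n)⁻¹
    · filter_upwards [hderiv] with a ha
      exact (hasDerivAt_iff_tendsto_slope_zero.1
        (ha z₀ (Metric.mem_ball_self (by positivity)))).comp hδ0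
  -- Cauchy's estimate on circles of radius `ε / 4`, which lie in `U`, turns the majorant of `F`
  -- into one of its derivative.
  have hb : ∀ᵐ a ∂m, ∀ z ∈ Metric.ball z₀ (ε / 2),
      ‖deriv (fun z => F z a) z‖ ≤ h a / (ε / 4) := by
    filter_upwards [hdiff, hbound] with a ha hba z hz
    refine Complex.norm_deriv_le_of_forall_mem_sphere_norm_le (by positivity) ?_ fun w hw => ?_
    · exact ((ha.mono (hsub z hz))).diffContOnCl_ball subset_rfl
    · exact hba w (hsub z hz (Metric.sphere_subset_closedBall hw))
  refine (hasDerivAt_integral_of_dominated_loc_of_deriv_le (μ := m) (F := F)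
    (Metric.ball_mem_nhds z₀ (by positivity : (0 : ℝ) < ε / 2)) ?_ ?_ hmeas' hb
    (hint.div_const _) hderiv).2.differentiableAt.differentiableWithinAt
  · filter_upwards [hU.mem_nhds hz₀] with z hz using hmeas z hz
  · refine hint.mono' (hmeas _ hz₀) ?_
    filter_upwards [hbound] with a ha using ha z₀ hz₀

/-! ### The Duhamel operator integrating from `+∞`. -/

/-- The solution of `u' = -μ u + g` vanishing at `+∞`, given by the Duhamel integral. -/
noncomputable def tailOp (μ : ℂ) (g : ℝ → ℂ) (x : ℝ) : ℂ :=
  -∫ y in Ioi x, Complex.exp (μ * (y - x)) * g y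

/-- With `μ = 2iλ` the sign condition is `Im λ ≥ 0`; this bound is what confines the construction of
`ψ` to the closed upper half-plane. -/
theorem norm_exp_mul_sub_le_one {μ : ℂ} (hμ : μ.re ≤ 0) {x y : ℝ} (hxy : x < y) :
    ‖Complex.exp (μ * (y - x))‖ ≤ 1 := by
  rw [Complex.norm_exp, ← Complex.ofReal_sub, Complex.re_mul_ofReal]
  exact Real.exp_le_one_iff.2 (mul_nonpos_of_nonpos_of_nonneg hμ (by linarith))

theorem norm_tailOp_le {μ : ℂ} (hμ : μ.re ≤ 0) {g : ℝ → ℂ} {h : ℝ → ℝ} {x : ℝ}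
    (hh : IntegrableOn h (Ioi x)) (hgh : ∀ y, ‖g y‖ ≤ h y) :
    ‖tailOp μ g x‖ ≤ ∫ y in Ioi x, h y := by
  rw [tailOp, norm_neg]
  refine norm_integral_le_of_norm_le hh ?_
  filter_upwards [ae_restrict_mem measurableSet_Ioi] with y hy
  rw [norm_mul]
  calc _ ≤ 1 * ‖g y‖ := by gcongr; exact norm_exp_mul_sub_le_one hμ hy
    _ ≤ h y := by rw [one_mul]; exact hgh y

theorem hasDerivAt_integral_Ioi {E : Type*} [NormedAddCommGroup E] [NormedSpace ℝ E]
    [CompleteSpace E] {g : ℝ → E} (hg : Continuous g)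
    (hint : ∀ x, IntegrableOn g (Ioi x)) (x : ℝ) :
    HasDerivAt (fun x => ∫ y in Ioi x, g y) (-g x) x := by
  have h1 : (fun x => ∫ y in Ioi x, g y) =
      fun x => (∫ y in Ioi (0 : ℝ), g y) - ∫ y in (0 : ℝ)..x, g y := by
    funext x
    rw [← intervalIntegral.integral_interval_add_Ioi (hint 0) (hint x)]
    abel
  rw [h1]
  exact (intervalIntegral.integral_hasDerivAt_right (hg.intervalIntegrable _ _)
    (hg.stronglyMeasurableAtFilter _ _) hg.continuousAt).const_sub _

theorem hasDerivAt_tailOp {μ : ℂ} (hμ : μ.re ≤ 0) {g : ℝ → ℂ} (hg : Continuous g)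
    (hint : Integrable g) (x : ℝ) :
    HasDerivAt (tailOp μ g) (-μ * tailOp μ g x + g x) x := by
  -- Pulling `e^{-μx}` out of the integral leaves an integrand free of `x`, so the product rule and
  -- the fundamental theorem apply.
  have hfac : ∀ x, tailOp μ g x =
      -(Complex.exp (-(μ * x)) * ∫ y in Ioi x, Complex.exp (μ * y) * g y) := by
    intro x
    rw [tailOp, ← integral_const_mul]
    congr 1
    refine integral_congr_ae (Eventually.of_forall fun y => ?_)
    simp only
    rw [← mul_assoc, ← Complex.exp_add]
    congr 2
    ring
  have hc : Continuous fun y : ℝ => Complex.exp (μ * y) * g y := by fun_prop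
  have hI : ∀ x, IntegrableOn (fun y : ℝ => Complex.exp (μ * y) * g y) (Ioi x) := by
    intro x
    refine Integrable.bdd_mul (c := ‖Complex.exp (μ * x)‖) hint.integrableOn
      (by fun_prop : Continuous fun y : ℝ => Complex.exp (μ * y)).aestronglyMeasurable ?_
    filter_upwards [ae_restrict_mem measurableSet_Ioi] with y hy
    have : Complex.exp (μ * y) = Complex.exp (μ * (y - x)) * Complex.exp (μ * x) := by
      rw [← Complex.exp_add]; congr 1; ring
    rw [this, norm_mul]
    exact mul_le_of_le_one_left (norm_nonneg _) (norm_exp_mul_sub_le_one hμ hy)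
  have hlin : HasDerivAt (fun x : ℝ => -(μ * x)) (-μ) x := by
    simpa using ((hasDerivAt_id x).ofReal_comp.const_mul μ).fun_neg
  have h := (hlin.cexp.mul (hasDerivAt_integral_Ioi hc hI x)).fun_neg
  rw [show tailOp μ g = fun x => _ from funext hfac]
  refine h.congr_deriv ?_
  have : Complex.exp (-(μ * x)) * Complex.exp (μ * x) = 1 := by
    rw [← Complex.exp_add]; simp
  linear_combination g x * this

/-- The exponent has the form `κ * z` so that one statement serves both components, with `κ = 2i`
and `κ = 0`. -/
theorem continuousOn_tailOp {S : Set ℂ} {κ : ℂ} (hκ : ∀ z ∈ S, (κ * z).re ≤ 0)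
    {G : ℂ → ℝ → ℂ} {h : ℝ → ℝ} (hh : Integrable h) (hG : ∀ z ∈ S, Continuous (G z))
    (hb : ∀ z ∈ S, ∀ y, ‖G z y‖ ≤ h y) (hc : ∀ y, ContinuousOn (fun z => G z y) S) (x : ℝ) :
    ContinuousOn (fun z => tailOp (κ * z) (G z) x) S := by
  refine (continuousOn_of_dominated (bound := h) (fun z hz => ?_) (fun z hz => ?_)
    hh.integrableOn ?_).fun_neg
  · have := hG z hz
    exact (by fun_prop : Continuous fun y : ℝ =>
      Complex.exp (κ * z * (y - x)) * G z y).aestronglyMeasurable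
  · filter_upwards [ae_restrict_mem measurableSet_Ioi] with y hy
    rw [norm_mul]
    exact (mul_le_of_le_one_left (norm_nonneg _)
      (norm_exp_mul_sub_le_one (hκ z hz) hy)).trans (hb z hz y)
  · refine Eventually.of_forall fun y => ContinuousOn.mul ?_ (hc y)
    exact Continuous.continuousOn (by fun_prop)

theorem differentiableOn_tailOp {U : Set ℂ} (hU : IsOpen U) {κ : ℂ}
    (hκ : ∀ z ∈ U, (κ * z).re ≤ 0)
    {G : ℂ → ℝ → ℂ} {h : ℝ → ℝ} (hh : Integrable h) (hG : ∀ z ∈ U, Continuous (G z))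
    (hb : ∀ z ∈ U, ∀ y, ‖G z y‖ ≤ h y) (hd : ∀ y, DifferentiableOn ℂ (fun z => G z y) U)
    (x : ℝ) : DifferentiableOn ℂ (fun z => tailOp (κ * z) (G z) x) U := by
  refine (differentiableOn_integral_of_dominated hU (h := h) (fun z hz => ?_) ?_
    hh.integrableOn ?_).fun_neg
  · have := hG z hz
    exact (by fun_prop : Continuous fun y : ℝ =>
      Complex.exp (κ * z * (y - x)) * G z y).aestronglyMeasurable
  · filter_upwards [ae_restrict_mem measurableSet_Ioi] with y hy z hz
    rw [norm_mul]
    exact (mul_le_of_le_one_left (norm_nonneg _)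
      (norm_exp_mul_sub_le_one (hκ z hz) hy)).trans (hb z hz y)
  · refine Eventually.of_forall fun y => DifferentiableOn.mul ?_ (hd y)
    exact Differentiable.differentiableOn (by fun_prop)

/-! ### Admissible potentials and the exponential weight. -/

/-- Potentials for which the Jost solutions are constructed. -/
structure IsPotential (a : ℝ → ℂ) : Prop where
  cont : Continuous a
  integrable : Integrable a
  bounded : ∃ B, ∀ x, ‖a x‖ ≤ B

/-- The exponential weight for which a Volterra operator with kernel bounded by `C * w` has norm at
most `1 / 2`. -/
noncomputable def volterraWeight (C : ℝ) (w : ℝ → ℝ) (x : ℝ) : ℝ :=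
  Real.exp (2 * C * ∫ y in Ioi x, w y)

section weight

variable {C : ℝ} {w : ℝ → ℝ}

theorem volterraWeight_nonneg (x : ℝ) : 0 ≤ volterraWeight C w x := (Real.exp_pos _).le

theorem one_le_volterraWeight (hC : 0 ≤ C) (h0 : ∀ x, 0 ≤ w x) (x : ℝ) :
    1 ≤ volterraWeight C w x := by
  have : 0 ≤ ∫ y in Ioi x, w y := integral_nonneg h0
  exact Real.one_le_exp (by positivity)

theorem volterraWeight_le (hC : 0 ≤ C) (h0 : ∀ x, 0 ≤ w x) (hint : Integrable w) (x : ℝ) :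
    volterraWeight C w x ≤ Real.exp (2 * C * ∫ y, w y) := by
  refine Real.exp_le_exp.2 (mul_le_mul_of_nonneg_left ?_ (by positivity))
  exact setIntegral_le_integral hint (Eventually.of_forall h0)

theorem hasDerivAt_volterraWeight (hw : Continuous w) (hint : Integrable w) (x : ℝ) :
    HasDerivAt (volterraWeight C w) (-(2 * (C * w x * volterraWeight C w x))) x := by
  refine ((hasDerivAt_integral_Ioi hw (fun _ => hint.integrableOn) x).const_mul
    (2 * C)).exp.congr_deriv ?_
  rw [volterraWeight]
  ring

theorem tendsto_volterraWeight : Tendsto (volterraWeight C w) atTop (𝓝 1) := by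
  have h : Tendsto (fun x => ∫ y in Ioi x, w y) atTop (𝓝 0) :=
    tendsto_integral_Ioi_zero tendsto_id
  have := (Real.continuous_exp.tendsto _).comp (h.const_mul (2 * C))
  rw [mul_zero, Real.exp_zero] at this
  exact this

theorem integrable_mul_volterraWeight (hC : 0 ≤ C) (hw : Continuous w) (h0 : ∀ x, 0 ≤ w x)
    (hint : Integrable w) : Integrable fun y => C * w y * volterraWeight C w y := by
  have hc : Continuous (volterraWeight C w) :=
    continuous_iff_continuousAt.2 fun x => (hasDerivAt_volterraWeight hw hint x).continuousAt
  refine (hint.const_mul C).mul_bdd (c := Real.exp (2 * C * ∫ y, w y))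
    hc.aestronglyMeasurable (Eventually.of_forall fun x => ?_)
  rw [Real.norm_of_nonneg (volterraWeight_nonneg x)]
  exact volterraWeight_le hC h0 hint x

/-- The weight `E` satisfies `E' = -2CwE` and `E → 1` at `+∞`, so `CwE` has antiderivative `-E/2`.
The `1/2` is the contraction factor; the `-1` gives decay at `+∞`. -/
theorem integral_mul_volterraWeight (hC : 0 ≤ C) (hw : Continuous w) (h0 : ∀ x, 0 ≤ w x)
    (hint : Integrable w) (x : ℝ) :
    ∫ y in Ioi x, C * w y * volterraWeight C w y = 1 / 2 * (volterraWeight C w x - 1) := by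
  have h := integral_Ioi_of_hasDerivAt_of_tendsto' (a := x)
    (f := fun y => -(1 / 2) * volterraWeight C w y) (m := -(1 / 2) * 1)
    (f' := fun y => C * w y * volterraWeight C w y)
    (fun y _ => ((hasDerivAt_volterraWeight hw hint y).const_mul (-(1 / 2))).congr_deriv (by ring))
    (integrable_mul_volterraWeight hC hw h0 hint).integrableOn
    (tendsto_volterraWeight.const_mul _)
  rw [h]
  ring

end weight

/-! ### Neumann iterates: bounds, differentiability in `x`, regularity in `z`. -/

/-- The Neumann iterates of the Volterra equation for the normalised Jost solution. -/
noncomputable def jostIter (a b c : ℝ → ℂ) : ℕ → ℂ → ℝ → ℂ × ℂ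
  | 0, _, _ => (0, 1)
  | k + 1, z, x =>
    (tailOp (2 * Complex.I * z)
        (fun y => a y * (jostIter a b c k z y).1 + b y * (jostIter a b c k z y).2) x,
      -- The second equation has no oscillating factor; `0 * z` keeps the shape `κ * z`.
      tailOp (0 * z)
        (fun y => -a y * (jostIter a b c k z y).2 + z * c y * (jostIter a b c k z y).1) x)

/-- The part of the closed upper half-plane in a ball of radius `R`. -/
def upperBall (R : ℝ) : Set ℂ := {z | 0 ≤ z.im ∧ ‖z‖ ≤ R}

theorem two_I_mul_re_nonpos {z : ℂ} (hz : 0 ≤ z.im) : (2 * Complex.I * z).re ≤ 0 := by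
  simp [Complex.mul_re, Complex.mul_im]
  exact hz

section iterates

variable {a b c : ℝ → ℂ} {R : ℝ}

/-- The size of the coefficients. -/
noncomputable def coeffNorm (a b c : ℝ → ℂ) (x : ℝ) : ℝ := ‖a x‖ + ‖b x‖ + ‖c x‖

theorem coeffNorm_nonneg (x : ℝ) : 0 ≤ coeffNorm a b c x := by unfold coeffNorm; positivity

theorem continuous_coeffNorm (ha : IsPotential a) (hb : IsPotential b) (hc : IsPotential c) :
    Continuous (coeffNorm a b c) :=
  (ha.cont.norm.add hb.cont.norm).add hc.cont.norm

theorem integrable_coeffNorm (ha : IsPotential a) (hb : IsPotential b) (hc : IsPotential c) :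
    Integrable (coeffNorm a b c) :=
  (ha.integrable.norm.add hb.integrable.norm).add hc.integrable.norm

theorem norm_source_fst_le (hR : 0 ≤ R) (x : ℝ) {u : ℂ × ℂ} {M : ℝ} (hu : ‖u‖ ≤ M) :
    ‖a x * u.1 + b x * u.2‖ ≤ (1 + R) * coeffNorm a b c x * M := by
  have h1 := (norm_fst_le u).trans hu
  have h2 := (norm_snd_le u).trans hu
  have hM : 0 ≤ M := (norm_nonneg _).trans hu
  calc _ ≤ ‖a x‖ * ‖u.1‖ + ‖b x‖ * ‖u.2‖ := by
        rw [← norm_mul, ← norm_mul]; exact norm_add_le _ _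
    _ ≤ ‖a x‖ * M + ‖b x‖ * M := by gcongr
    _ ≤ 1 * coeffNorm a b c x * M := by
        rw [← add_mul, one_mul, coeffNorm]
        exact mul_le_mul_of_nonneg_right (by linarith [norm_nonneg (c x)]) hM
    _ ≤ _ := by
        have := coeffNorm_nonneg (a := a) (b := b) (c := c) x
        gcongr
        linarith

/-- The factor `z` in this source term is the origin of the constant `1 + R` and the reason for
working on bounded pieces `upperBall R`. -/
theorem norm_source_snd_le {z : ℂ} (hz : ‖z‖ ≤ R) (x : ℝ) {u : ℂ × ℂ} {M : ℝ} (hu : ‖u‖ ≤ M) :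
    ‖-a x * u.2 + z * c x * u.1‖ ≤ (1 + R) * coeffNorm a b c x * M := by
  have h1 := (norm_fst_le u).trans hu
  have h2 := (norm_snd_le u).trans hu
  have hM : 0 ≤ M := (norm_nonneg _).trans hu
  have hR : 0 ≤ R := (norm_nonneg _).trans hz
  calc _ ≤ ‖a x‖ * ‖u.2‖ + ‖z‖ * ‖c x‖ * ‖u.1‖ := by
        rw [← norm_neg (a x), ← norm_mul, ← norm_mul, ← norm_mul]; exact norm_add_le _ _
    _ ≤ ‖a x‖ * M + R * ‖c x‖ * M := by gcongr
    _ ≤ _ := by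
        rw [← add_mul, coeffNorm]
        gcongr
        nlinarith [norm_nonneg (a x), norm_nonneg (b x), norm_nonneg (c x),
          mul_nonneg hR (norm_nonneg (a x)), mul_nonneg hR (norm_nonneg (b x))]

/-- The weight bounding the Neumann iterates uniformly on `upperBall R`. -/
noncomputable def iterWeight (a b c : ℝ → ℂ) (R : ℝ) : ℝ → ℝ :=
  volterraWeight (1 + R) (coeffNorm a b c)

/-- The majorant of the source terms of the Volterra equation. -/
noncomputable def sourceBound (a b c : ℝ → ℂ) (R : ℝ) (y : ℝ) : ℝ :=
  (1 + R) * coeffNorm a b c y * iterWeight a b c R y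

theorem continuous_source_fst (ha : IsPotential a) (hb : IsPotential b) {u : ℝ → ℂ × ℂ}
    (hu : Continuous u) : Continuous fun y => a y * (u y).1 + b y * (u y).2 :=
  (ha.cont.mul hu.fst).add (hb.cont.mul hu.snd)

theorem continuous_source_snd (ha : IsPotential a) (hc : IsPotential c) (z : ℂ) {u : ℝ → ℂ × ℂ}
    (hu : Continuous u) : Continuous fun y => -a y * (u y).2 + z * c y * (u y).1 :=
  (ha.cont.neg.mul hu.snd).add ((continuous_const.mul hc.cont).mul hu.fst)

theorem integrable_sourceBound (ha : IsPotential a) (hb : IsPotential b) (hc : IsPotential c)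
    (hR : 0 ≤ R) : Integrable (sourceBound a b c R) :=
  integrable_mul_volterraWeight (by linarith) (continuous_coeffNorm ha hb hc) coeffNorm_nonneg
    (integrable_coeffNorm ha hb hc)

theorem jostIter_source_fst_le (hR : 0 ≤ R) {k : ℕ} {z : ℂ}
    (h : ∀ x, ‖jostIter a b c k z x‖ ≤ (1 / 2) ^ k * iterWeight a b c R x) (y : ℝ) :
    ‖a y * (jostIter a b c k z y).1 + b y * (jostIter a b c k z y).2‖ ≤
      (1 / 2) ^ k * sourceBound a b c R y := by
  refine (norm_source_fst_le (c := c) hR y (h y)).trans_eq ?_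
  rw [sourceBound]; ring

theorem jostIter_source_snd_le {k : ℕ} {z : ℂ} (hz : ‖z‖ ≤ R)
    (h : ∀ x, ‖jostIter a b c k z x‖ ≤ (1 / 2) ^ k * iterWeight a b c R x) (y : ℝ) :
    ‖-a y * (jostIter a b c k z y).2 + z * c y * (jostIter a b c k z y).1‖ ≤
      (1 / 2) ^ k * sourceBound a b c R y := by
  refine (norm_source_snd_le (b := b) hz y (h y)).trans_eq ?_
  rw [sourceBound]; ring

/-- Convergence needs only the factor `(1/2)^(k+1)`; the sharper `iterWeight - 1`, which tends to
`0`, yields the asymptotics at `+∞`. -/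
theorem norm_jostIter_succ_le_of (ha : IsPotential a) (hb : IsPotential b) (hc : IsPotential c)
    {k : ℕ} {z : ℂ} (hz : z ∈ upperBall R)
    (h : ∀ x, ‖jostIter a b c k z x‖ ≤ (1 / 2) ^ k * iterWeight a b c R x) (x : ℝ) :
    ‖jostIter a b c (k + 1) z x‖ ≤ (1 / 2) ^ (k + 1) * (iterWeight a b c R x - 1) := by
  have hR : 0 ≤ R := (norm_nonneg _).trans hz.2
  have hint := ((integrable_sourceBound ha hb hc hR).const_mul ((1 / 2 : ℝ) ^ k)).integrableOn
    (s := Ioi x)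
  have hval : ∫ y in Ioi x, (1 / 2 : ℝ) ^ k * sourceBound a b c R y =
      (1 / 2) ^ (k + 1) * (iterWeight a b c R x - 1) := by
    rw [integral_const_mul]
    simp only [sourceBound, iterWeight]
    rw [integral_mul_volterraWeight (by linarith) (continuous_coeffNorm ha hb hc)
      coeffNorm_nonneg (integrable_coeffNorm ha hb hc)]
    ring
  rw [← hval, Prod.norm_def]
  exact max_le
    (norm_tailOp_le (two_I_mul_re_nonpos hz.1) hint (jostIter_source_fst_le hR h))
    (norm_tailOp_le (by simp) hint (jostIter_source_snd_le hz.2 h))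

theorem norm_jostIter_le (ha : IsPotential a) (hb : IsPotential b) (hc : IsPotential c)
    {z : ℂ} (hz : z ∈ upperBall R) (k : ℕ) (x : ℝ) :
    ‖jostIter a b c k z x‖ ≤ (1 / 2) ^ k * iterWeight a b c R x := by
  have hR : 0 ≤ R := (norm_nonneg _).trans hz.2
  induction k generalizing x with
  | zero =>
    have : 1 ≤ iterWeight a b c R x := one_le_volterraWeight (by linarith) coeffNorm_nonneg x
    simpa [jostIter] using this
  | succ k ih =>
    refine (norm_jostIter_succ_le_of ha hb hc hz ih x).trans ?_
    gcongr
    linarith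

theorem norm_jostIter_succ_le (ha : IsPotential a) (hb : IsPotential b) (hc : IsPotential c)
    {z : ℂ} (hz : z ∈ upperBall R) (k : ℕ) (x : ℝ) :
    ‖jostIter a b c (k + 1) z x‖ ≤ (1 / 2) ^ (k + 1) * (iterWeight a b c R x - 1) :=
  norm_jostIter_succ_le_of ha hb hc hz (norm_jostIter_le ha hb hc hz k) x

theorem continuous_jostIter (ha : IsPotential a) (hb : IsPotential b) (hc : IsPotential c)
    {z : ℂ} (hz : 0 ≤ z.im) (k : ℕ) : Continuous (jostIter a b c k z) := by
  -- For a single `z` the radius `‖z‖` suffices.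
  have hz' : z ∈ upperBall ‖z‖ := ⟨hz, le_rfl⟩
  induction k with
  | zero => exact continuous_const
  | succ k ih =>
    have hint := (integrable_sourceBound ha hb hc (norm_nonneg z)).const_mul ((1 / 2 : ℝ) ^ k)
    have hbd := norm_jostIter_le ha hb hc hz' k
    have h1 := continuous_source_fst ha hb ih
    have h2 := continuous_source_snd ha hc z ih
    refine continuous_iff_continuousAt.2 fun x => ContinuousAt.prodMk ?_ ?_
    · exact (hasDerivAt_tailOp (two_I_mul_re_nonpos hz) h1 (hint.mono' h1.aestronglyMeasurable
        (Eventually.of_forall (jostIter_source_fst_le (norm_nonneg z) hbd))) x).continuousAt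
    · exact (hasDerivAt_tailOp (by simp) h2 (hint.mono' h2.aestronglyMeasurable
        (Eventually.of_forall (jostIter_source_snd_le le_rfl hbd))) x).continuousAt

theorem hasDerivAt_jostIter_succ (ha : IsPotential a) (hb : IsPotential b) (hc : IsPotential c)
    {z : ℂ} (hz : 0 ≤ z.im) (k : ℕ) (x : ℝ) :
    HasDerivAt (fun x => (jostIter a b c (k + 1) z x).1)
      (-(2 * Complex.I * z) * (jostIter a b c (k + 1) z x).1 +
        (a x * (jostIter a b c k z x).1 + b x * (jostIter a b c k z x).2)) x ∧
    HasDerivAt (fun x => (jostIter a b c (k + 1) z x).2)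
      (-a x * (jostIter a b c k z x).2 + z * c x * (jostIter a b c k z x).1) x := by
  have hz' : z ∈ upperBall ‖z‖ := ⟨hz, le_rfl⟩
  have hint := (integrable_sourceBound ha hb hc (norm_nonneg z)).const_mul ((1 / 2 : ℝ) ^ k)
  have hbd := norm_jostIter_le ha hb hc hz' k
  have hcont := continuous_jostIter ha hb hc hz k
  have h1 := continuous_source_fst ha hb hcont
  have h2 := continuous_source_snd ha hc z hcont
  constructor
  · exact hasDerivAt_tailOp (two_I_mul_re_nonpos hz) h1 (hint.mono' h1.aestronglyMeasurable
        (Eventually.of_forall (jostIter_source_fst_le (norm_nonneg z) hbd))) x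
  · refine (hasDerivAt_tailOp (by simp) h2 (hint.mono' h2.aestronglyMeasurable
        (Eventually.of_forall (jostIter_source_snd_le le_rfl hbd))) x).congr_deriv ?_
    simp

theorem continuousOn_jostIter (ha : IsPotential a) (hb : IsPotential b) (hc : IsPotential c)
    (k : ℕ) (x : ℝ) : ContinuousOn (fun z => jostIter a b c k z x) (upperBall R) := by
  by_cases hR : 0 ≤ R
  swap
  · refine fun z hz => absurd ((norm_nonneg _).trans hz.2) hR
  induction k generalizing x with
  | zero => exact continuousOn_const
  | succ k ih =>
    have hint := (integrable_sourceBound ha hb hc hR).const_mul ((1 / 2 : ℝ) ^ k)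
    refine ContinuousOn.prodMk ?_ ?_
    · refine continuousOn_tailOp (fun z hz => two_I_mul_re_nonpos hz.1) hint
        (fun z hz => continuous_source_fst ha hb (continuous_jostIter ha hb hc hz.1 k))
        (fun z hz => jostIter_source_fst_le hR (norm_jostIter_le ha hb hc hz k))
        (fun y => ?_) x
      exact (continuousOn_const.mul (ih y).fst).add (continuousOn_const.mul (ih y).snd)
    · refine continuousOn_tailOp (fun z hz => by simp) hint
        (fun z hz => continuous_source_snd ha hc z (continuous_jostIter ha hb hc hz.1 k))
        (fun z hz => jostIter_source_snd_le hz.2 (norm_jostIter_le ha hb hc hz k))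
        (fun y => ?_) x
      exact (continuousOn_const.mul (ih y).snd).add
        ((continuousOn_id.mul continuousOn_const).mul (ih y).fst)

theorem differentiableOn_jostIter (ha : IsPotential a) (hb : IsPotential b) (hc : IsPotential c)
    {U : Set ℂ} (hU : IsOpen U) (hUR : U ⊆ upperBall R) (k : ℕ) (x : ℝ) :
    DifferentiableOn ℂ (fun z => (jostIter a b c k z x).1) U ∧
      DifferentiableOn ℂ (fun z => (jostIter a b c k z x).2) U := by
  by_cases hR : 0 ≤ R
  swap
  · have : ∀ z ∈ U, False := fun z hz => hR ((norm_nonneg _).trans (hUR hz).2)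
    exact ⟨fun z hz => (this z hz).elim, fun z hz => (this z hz).elim⟩
  induction k generalizing x with
  | zero => exact ⟨differentiableOn_const _, differentiableOn_const _⟩
  | succ k ih =>
    have hint := (integrable_sourceBound ha hb hc hR).const_mul ((1 / 2 : ℝ) ^ k)
    constructor
    · refine differentiableOn_tailOp hU (fun z hz => two_I_mul_re_nonpos (hUR hz).1) hint
        (fun z hz => continuous_source_fst ha hb (continuous_jostIter ha hb hc (hUR hz).1 k))
        (fun z hz => jostIter_source_fst_le hR (norm_jostIter_le ha hb hc (hUR hz) k))
        (fun y => ?_) x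
      exact ((ih y).1.const_mul _).add ((ih y).2.const_mul _)
    · refine differentiableOn_tailOp hU (fun z hz => by simp) hint
        (fun z hz => continuous_source_snd ha hc z (continuous_jostIter ha hb hc (hUR hz).1 k))
        (fun z hz => jostIter_source_snd_le (hUR hz).2 (norm_jostIter_le ha hb hc (hUR hz) k))
        (fun y => ?_) x
      exact ((ih y).2.const_mul _).add ((differentiableOn_id.mul_const _).mul (ih y).1)

end iterates

/-! ### The sum of the Neumann series: asymptotics, differential equation, regularity. -/

/-- First component of the Neumann series. -/
noncomputable def jostFst (a b c : ℝ → ℂ) (z : ℂ) (x : ℝ) : ℂ := ∑' k, (jostIter a b c k z x).1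

/-- Second component of the Neumann series. -/
noncomputable def jostSnd (a b c : ℝ → ℂ) (z : ℂ) (x : ℝ) : ℂ := ∑' k, (jostIter a b c k z x).2

section series

variable {a b c : ℝ → ℂ} {R : ℝ}

theorem summable_half_pow_mul (M : ℝ) : Summable fun k : ℕ => (1 / 2 : ℝ) ^ k * M :=
  summable_geometric_two.mul_right M

theorem summable_jostIter (ha : IsPotential a) (hb : IsPotential b) (hc : IsPotential c)
    {z : ℂ} (hz : 0 ≤ z.im) (x : ℝ) :
    Summable (fun k => (jostIter a b c k z x).1) ∧
      Summable (fun k => (jostIter a b c k z x).2) := by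
  have hbd := fun k => norm_jostIter_le ha hb hc (R := ‖z‖) ⟨hz, le_rfl⟩ k x
  exact ⟨.of_norm_bounded (summable_half_pow_mul _) fun k => (norm_fst_le _).trans (hbd k),
    .of_norm_bounded (summable_half_pow_mul _) fun k => (norm_snd_le _).trans (hbd k)⟩

theorem jostFst_eq_tsum_succ (ha : IsPotential a) (hb : IsPotential b) (hc : IsPotential c)
    {z : ℂ} (hz : 0 ≤ z.im) (x : ℝ) :
    jostFst a b c z x = ∑' k, (jostIter a b c (k + 1) z x).1 := by
  rw [jostFst, (summable_jostIter ha hb hc hz x).1.tsum_eq_zero_add]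
  simp [jostIter]

theorem jostSnd_eq_tsum_succ (ha : IsPotential a) (hb : IsPotential b) (hc : IsPotential c)
    {z : ℂ} (hz : 0 ≤ z.im) (x : ℝ) :
    jostSnd a b c z x = 1 + ∑' k, (jostIter a b c (k + 1) z x).2 := by
  rw [jostSnd, (summable_jostIter ha hb hc hz x).2.tsum_eq_zero_add]
  simp [jostIter]

/-- The geometric factors `(1/2)^(k+1)` sum to `1`, so the bound on the iterates passes to the sum
unchanged. -/
theorem norm_jostFst_le (ha : IsPotential a) (hb : IsPotential b) (hc : IsPotential c)
    {z : ℂ} (hz : 0 ≤ z.im) (x : ℝ) :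
    ‖jostFst a b c z x‖ ≤ iterWeight a b c ‖z‖ x - 1 := by
  rw [jostFst_eq_tsum_succ ha hb hc hz]
  have hsum : HasSum (fun k : ℕ => (1 / 2 : ℝ) ^ (k + 1) * (iterWeight a b c ‖z‖ x - 1))
      (iterWeight a b c ‖z‖ x - 1) := by
    simpa only [pow_succ', one_div, mul_assoc, mul_left_comm, mul_inv_cancel_left₀,
      inv_mul_cancel_left₀, ne_eq, OfNat.ofNat_ne_zero, not_false_eq_true] using
      (hasSum_geometric_two.mul_right (1 / 2 * (iterWeight a b c ‖z‖ x - 1)))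
  exact tsum_of_norm_bounded hsum fun k => (norm_fst_le _).trans
    (norm_jostIter_succ_le ha hb hc ⟨hz, le_rfl⟩ k x)

theorem norm_jostSnd_sub_one_le (ha : IsPotential a) (hb : IsPotential b) (hc : IsPotential c)
    {z : ℂ} (hz : 0 ≤ z.im) (x : ℝ) :
    ‖jostSnd a b c z x - 1‖ ≤ iterWeight a b c ‖z‖ x - 1 := by
  rw [jostSnd_eq_tsum_succ ha hb hc hz, add_sub_cancel_left]
  have hsum : HasSum (fun k : ℕ => (1 / 2 : ℝ) ^ (k + 1) * (iterWeight a b c ‖z‖ x - 1))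
      (iterWeight a b c ‖z‖ x - 1) := by
    simpa only [pow_succ', one_div, mul_assoc, mul_left_comm, mul_inv_cancel_left₀,
      inv_mul_cancel_left₀, ne_eq, OfNat.ofNat_ne_zero, not_false_eq_true] using
      (hasSum_geometric_two.mul_right (1 / 2 * (iterWeight a b c ‖z‖ x - 1)))
  exact tsum_of_norm_bounded hsum fun k => (norm_snd_le _).trans
    (norm_jostIter_succ_le ha hb hc ⟨hz, le_rfl⟩ k x)

theorem tendsto_iterWeight : Tendsto (iterWeight a b c R) atTop (𝓝 1) := tendsto_volterraWeight

theorem tendsto_jostFst (ha : IsPotential a) (hb : IsPotential b) (hc : IsPotential c)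
    {z : ℂ} (hz : 0 ≤ z.im) : Tendsto (jostFst a b c z) atTop (𝓝 0) := by
  refine squeeze_zero_norm (norm_jostFst_le ha hb hc hz) ?_
  simpa using (tendsto_iterWeight (a := a) (b := b) (c := c) (R := ‖z‖)).sub_const 1

theorem tendsto_jostSnd (ha : IsPotential a) (hb : IsPotential b) (hc : IsPotential c)
    {z : ℂ} (hz : 0 ≤ z.im) : Tendsto (jostSnd a b c z) atTop (𝓝 1) := by
  rw [tendsto_iff_norm_sub_tendsto_zero]
  refine squeeze_zero (fun _ => norm_nonneg _) (norm_jostSnd_sub_one_le ha hb hc hz) ?_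
  simpa using (tendsto_iterWeight (a := a) (b := b) (c := c) (R := ‖z‖)).sub_const 1

/-- Termwise differentiation in `x` needs a summable majorant of the derivatives that is uniform in
`x`; boundedness of the potentials supplies it. -/
theorem exists_source_bound (ha : IsPotential a) (hb : IsPotential b) (hc : IsPotential c)
    {z : ℂ} (hz : 0 ≤ z.im) : ∃ M, ∀ k x,
      ‖jostIter a b c k z x‖ ≤ (1 / 2) ^ k * M ∧
      ‖a x * (jostIter a b c k z x).1 + b x * (jostIter a b c k z x).2‖ ≤ (1 / 2) ^ k * M ∧
      ‖-a x * (jostIter a b c k z x).2 + z * c x * (jostIter a b c k z x).1‖ ≤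
        (1 / 2) ^ k * M := by
  obtain ⟨A, hA⟩ := ha.bounded
  obtain ⟨B, hB⟩ := hb.bounded
  obtain ⟨D, hD⟩ := hc.bounded
  set E := Real.exp (2 * (1 + ‖z‖) * ∫ y, coeffNorm a b c y) with hE
  have hw : ∀ x, iterWeight a b c ‖z‖ x ≤ E := fun x =>
    volterraWeight_le (by positivity) coeffNorm_nonneg (integrable_coeffNorm ha hb hc) x
  have hE0 : 0 ≤ E := (Real.exp_pos _).le
  have hs : ∀ x, sourceBound a b c ‖z‖ x ≤ (1 + ‖z‖) * (A + B + D) * E := by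
    intro x
    have h1 : coeffNorm a b c x ≤ A + B + D := add_le_add (add_le_add (hA x) (hB x)) (hD x)
    have h0 := coeffNorm_nonneg (a := a) (b := b) (c := c) x
    have h2 : 0 ≤ A + B + D := h0.trans h1
    rw [sourceBound]
    gcongr
    · exact volterraWeight_nonneg x
    · exact hw x
  refine ⟨max E ((1 + ‖z‖) * (A + B + D) * E), fun k x => ?_⟩
  have hbd := norm_jostIter_le ha hb hc (R := ‖z‖) ⟨hz, le_rfl⟩ k
  refine ⟨(hbd x).trans ?_, (jostIter_source_fst_le (norm_nonneg z) hbd x).trans ?_,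
    (jostIter_source_snd_le le_rfl hbd x).trans ?_⟩
  · gcongr
    exact (hw x).trans (le_max_left _ _)
  · gcongr
    exact (hs x).trans (le_max_right _ _)
  · gcongr
    exact (hs x).trans (le_max_right _ _)

theorem hasDerivAt_jostFst (ha : IsPotential a) (hb : IsPotential b) (hc : IsPotential c)
    {z : ℂ} (hz : 0 ≤ z.im) (x : ℝ) :
    HasDerivAt (jostFst a b c z)
      (-(2 * Complex.I * z) * jostFst a b c z x +
        (a x * jostFst a b c z x + b x * jostSnd a b c z x)) x := by
  obtain ⟨M, hM⟩ := exists_source_bound ha hb hc hz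
  obtain ⟨h1, h2⟩ := summable_jostIter ha hb hc hz x
  have h1' := (summable_nat_add_iff 1).2 h1
  -- The derivative of iterate `k + 1` has a linear part carrying index `k + 1`, hence the extra `1
  -- / 2`, and a source carrying index `k`.
  have hu := summable_half_pow_mul (‖-(2 * Complex.I * z)‖ * (1 / 2 * M) + M)
  have hd := hasDerivAt_tsum hu (fun k y => (hasDerivAt_jostIter_succ ha hb hc hz k y).1)
    (fun k y => ?_) (y₀ := x) h1' x
  · refine (hd.congr_of_eventuallyEq
      (Eventually.of_forall (jostFst_eq_tsum_succ ha hb hc hz))).congr_deriv ?_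
    -- The linear part sums over indices `k + 1` only, which is still all of `jostFst` because the
    -- zeroth first component is `0`.
    rw [(h1'.mul_left _).tsum_add ((h1.mul_left _).add (h2.mul_left _)),
      (h1.mul_left _).tsum_add (h2.mul_left _), tsum_mul_left, tsum_mul_left, tsum_mul_left,
      ← jostFst_eq_tsum_succ ha hb hc hz, ← jostFst, ← jostSnd]
  · refine (norm_add_le _ _).trans ?_
    rw [mul_add, norm_mul]
    refine add_le_add ?_ (hM k y).2.1
    calc _ ≤ ‖-(2 * Complex.I * z)‖ * ((1 / 2) ^ (k + 1) * M) := by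
          gcongr; exact (norm_fst_le _).trans (hM (k + 1) y).1
      _ = _ := by ring

theorem hasDerivAt_jostSnd (ha : IsPotential a) (hb : IsPotential b) (hc : IsPotential c)
    {z : ℂ} (hz : 0 ≤ z.im) (x : ℝ) :
    HasDerivAt (jostSnd a b c z)
      (-a x * jostSnd a b c z x + z * c x * jostFst a b c z x) x := by
  obtain ⟨M, hM⟩ := exists_source_bound ha hb hc hz
  obtain ⟨h1, h2⟩ := summable_jostIter ha hb hc hz x
  have h2' := (summable_nat_add_iff 1).2 h2
  have hd := hasDerivAt_tsum (summable_half_pow_mul M)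
    (fun k y => (hasDerivAt_jostIter_succ ha hb hc hz k y).2)
    (fun k y => (hM k y).2.2) (y₀ := x) h2' x
  refine ((hd.const_add 1).congr_of_eventuallyEq
    (Eventually.of_forall (jostSnd_eq_tsum_succ ha hb hc hz))).congr_deriv ?_
  rw [(h2.mul_left _).tsum_add (h1.mul_left _), tsum_mul_left, tsum_mul_left,
    ← jostFst, ← jostSnd]

theorem continuousOn_jost (ha : IsPotential a) (hb : IsPotential b) (hc : IsPotential c) (x : ℝ) :
    ContinuousOn (fun z => jostFst a b c z x) {z | 0 ≤ z.im} ∧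
      ContinuousOn (fun z => jostSnd a b c z x) {z | 0 ≤ z.im} := by
  -- Continuity is local, and near `z` the series converges uniformly on `upperBall (‖z‖ + 1)`.
  have hnear : ∀ z : ℂ, upperBall (‖z‖ + 1) ∈ 𝓝[{z | 0 ≤ z.im}] z := by
    intro z
    filter_upwards [self_mem_nhdsWithin, mem_nhdsWithin_of_mem_nhds
      (Metric.ball_mem_nhds z one_pos)] with w hw hw'
    refine ⟨hw, ?_⟩
    rw [Metric.mem_ball, dist_eq_norm] at hw'
    linarith [norm_le_norm_add_norm_sub' w z]
  have hmem : ∀ z : ℂ, 0 ≤ z.im → z ∈ upperBall (‖z‖ + 1) := fun z hz => ⟨hz, by linarith⟩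
  constructor
  · intro z hz
    refine ContinuousWithinAt.mono_of_mem_nhdsWithin (t := upperBall (‖z‖ + 1)) ?_ (hnear z)
    refine continuousOn_tsum (fun k => (continuousOn_jostIter ha hb hc k x).fst)
      (summable_half_pow_mul (iterWeight a b c (‖z‖ + 1) x)) (fun k w hw => ?_) z (hmem z hz)
    exact (norm_fst_le _).trans (norm_jostIter_le ha hb hc hw k x)
  · intro z hz
    refine ContinuousWithinAt.mono_of_mem_nhdsWithin (t := upperBall (‖z‖ + 1)) ?_ (hnear z)
    refine continuousOn_tsum (fun k => (continuousOn_jostIter ha hb hc k x).snd)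
      (summable_half_pow_mul (iterWeight a b c (‖z‖ + 1) x)) (fun k w hw => ?_) z (hmem z hz)
    exact (norm_snd_le _).trans (norm_jostIter_le ha hb hc hw k x)

theorem isOpen_upperPlane : IsOpen upperPlane := isOpen_lt continuous_const Complex.continuous_im

theorem analyticOnNhd_jost (ha : IsPotential a) (hb : IsPotential b) (hc : IsPotential c) (x : ℝ) :
    AnalyticOnNhd ℂ (fun z => jostFst a b c z x) upperPlane ∧
      AnalyticOnNhd ℂ (fun z => jostSnd a b c z x) upperPlane := by
  have key : ∀ z ∈ upperPlane, DifferentiableAt ℂ (fun z => jostFst a b c z x) z ∧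
      DifferentiableAt ℂ (fun z => jostSnd a b c z x) z := by
    intro z hz
    set U := upperPlane ∩ Metric.ball z 1 with hUdef
    have hU : IsOpen U := isOpen_upperPlane.inter Metric.isOpen_ball
    have hUR : U ⊆ upperBall (‖z‖ + 1) := by
      rintro w ⟨hw, hw'⟩
      refine ⟨le_of_lt hw, ?_⟩
      rw [Metric.mem_ball, dist_eq_norm] at hw'
      linarith [norm_le_norm_add_norm_sub' w z]
    have hzU : U ∈ 𝓝 z := hU.mem_nhds ⟨hz, Metric.mem_ball_self one_pos⟩
    have hs := summable_half_pow_mul (iterWeight a b c (‖z‖ + 1) x)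
    exact ⟨(Complex.differentiableOn_tsum_of_summable_norm hs
        (fun k => (differentiableOn_jostIter ha hb hc hU hUR k x).1) hU fun k w hw =>
          (norm_fst_le _).trans (norm_jostIter_le ha hb hc (hUR hw) k x)).differentiableAt hzU,
      (Complex.differentiableOn_tsum_of_summable_norm hs
        (fun k => (differentiableOn_jostIter ha hb hc hU hUR k x).2) hU fun k w hw =>
          (norm_snd_le _).trans (norm_jostIter_le ha hb hc (hUR hw) k x)).differentiableAt hzU⟩
  exact ⟨DifferentiableOn.analyticOnNhd (fun z hz => (key z hz).1.differentiableWithinAt)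
      isOpen_upperPlane,
    DifferentiableOn.analyticOnNhd (fun z hz => (key z hz).2.differentiableWithinAt)
      isOpen_upperPlane⟩

end series

/-! ### The linear system and uniqueness of `ψ`. -/

theorem isSolution_iff {q r : ℝ → ℂ} {ζ : ℂ} {f : ℝ → Fin 2 → ℂ} :
    IsSolution q r ζ f ↔ ∀ x,
      HasDerivAt (fun x => f x 0)
        ((-(Complex.I * ζ ^ 2) - Complex.I / 2 * (q x * r x)) * f x 0 + ζ * q x * f x 1) x ∧
      HasDerivAt (fun x => f x 1)
        (ζ * r x * f x 0 + (Complex.I * ζ ^ 2 + Complex.I / 2 * (q x * r x)) * f x 1) x := by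
  refine forall_congr' fun x => ?_
  rw [hasDerivAt_pi, Fin.forall_fin_two]
  simp [systemMatrix, Matrix.mulVec, dotProduct, Fin.sum_univ_two]

theorem IsPotential.mul {q r : ℝ → ℂ} (hq : IsPotential q) (hr : IsPotential r) :
    IsPotential fun x => q x * r x := by
  obtain ⟨B, hB⟩ := hq.bounded
  obtain ⟨D, hD⟩ := hr.bounded
  refine ⟨hq.cont.mul hr.cont, ?_, B * D, fun x => ?_⟩
  · exact hr.integrable.bdd_mul hq.cont.aestronglyMeasurable (Eventually.of_forall hB)
  · rw [norm_mul]
    exact mul_le_mul (hB x) (hD x) (norm_nonneg _) ((norm_nonneg _).trans (hB x))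

theorem IsPotential.const_mul {q : ℝ → ℂ} (hq : IsPotential q) (k : ℂ) :
    IsPotential fun x => k * q x := by
  obtain ⟨B, hB⟩ := hq.bounded
  refine ⟨continuous_const.mul hq.cont, hq.integrable.const_mul k, ‖k‖ * B, fun x => ?_⟩
  rw [norm_mul]
  exact mul_le_mul_of_nonneg_left (hB x) (norm_nonneg _)

theorem IsPotential.neg_comp_neg {q : ℝ → ℂ} (hq : IsPotential q) :
    IsPotential fun x => -q (-x) := by
  obtain ⟨B, hB⟩ := hq.bounded
  exact ⟨(hq.cont.comp continuous_neg).neg, hq.integrable.comp_neg.neg, B, fun x => by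
    rw [norm_neg]; exact hB _⟩

theorem isPotential_schwartz (q : 𝓢(ℝ, ℂ)) : IsPotential q :=
  ⟨q.continuous, q.integrable, by
    obtain ⟨B, hB⟩ := q.decay 0 0
    exact ⟨B, fun x => by simpa using hB.2 x⟩⟩

/-- One Lipschitz constant for all `x` allows ODE uniqueness to be applied on the whole line. -/
theorem exists_lipschitzWith_systemMatrix {q r : ℝ → ℂ} (hq : IsPotential q) (hr : IsPotential r)
    (ζ : ℂ) : ∃ K, ∀ x, LipschitzWith K fun u : Fin 2 → ℂ => systemMatrix q r ζ x *ᵥ u := by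
  obtain ⟨B, hB⟩ := hq.bounded
  obtain ⟨D, hD⟩ := hr.bounded
  obtain ⟨E, hE⟩ := (hq.mul hr).bounded
  have hB0 : 0 ≤ B := (norm_nonneg _).trans (hB 0)
  have hD0 : 0 ≤ D := (norm_nonneg _).trans (hD 0)
  have hE0 : 0 ≤ E := (norm_nonneg _).trans (hE 0)
  set L : ℝ := ‖ζ‖ ^ 2 + 1 / 2 * E + ‖ζ‖ * B + ‖ζ‖ * D with hL
  have hL0 : 0 ≤ L := by positivity
  have hdiag : ∀ x, ‖Complex.I * ζ ^ 2 + Complex.I / 2 * (q x * r x)‖ ≤ L := by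
    intro x
    refine (norm_add_le _ _).trans ?_
    have h1 : ‖Complex.I * ζ ^ 2‖ = ‖ζ‖ ^ 2 := by simp
    have h2 : ‖Complex.I / 2 * (q x * r x)‖ = 1 / 2 * ‖q x * r x‖ := by
      rw [norm_mul]; simp
    rw [h1, h2]
    have := hE x
    have h3 : 0 ≤ ‖ζ‖ * B := by positivity
    have h4 : 0 ≤ ‖ζ‖ * D := by positivity
    linarith
  have hq' : ∀ x, ‖ζ * q x‖ ≤ L := by
    intro x
    rw [norm_mul]
    have h1 := mul_le_mul_of_nonneg_left (hB x) (norm_nonneg ζ)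
    have h4 : 0 ≤ ‖ζ‖ * D := by positivity
    nlinarith [sq_nonneg ‖ζ‖]
  have hr' : ∀ x, ‖ζ * r x‖ ≤ L := by
    intro x
    rw [norm_mul]
    have h1 := mul_le_mul_of_nonneg_left (hD x) (norm_nonneg ζ)
    have h4 : 0 ≤ ‖ζ‖ * B := by positivity
    nlinarith [sq_nonneg ‖ζ‖]
  have hentry : ∀ x i j, ‖systemMatrix q r ζ x i j‖ ≤ L := by
    intro x
    rw [Fin.forall_fin_two, Fin.forall_fin_two, Fin.forall_fin_two]
    refine ⟨⟨?_, hq' x⟩, hr' x, hdiag x⟩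
    rw [show systemMatrix q r ζ x 0 0 = -(Complex.I * ζ ^ 2 + Complex.I / 2 * (q x * r x)) from
      (by ring : -(Complex.I * ζ ^ 2) - Complex.I / 2 * (q x * r x) = _), norm_neg]
    exact hdiag x
  -- Each row has two entries of size at most `L`, and vectors carry the sup norm.
  refine ⟨(2 * L).toNNReal, fun x => LipschitzWith.of_dist_le_mul fun u v => ?_⟩
  rw [dist_eq_norm, dist_eq_norm, ← Matrix.mulVec_sub]
  rw [Real.coe_toNNReal _ (by positivity)]
  refine (pi_norm_le_iff_of_nonneg (by positivity)).2
    fun i => ?_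
  rw [Matrix.mulVec_apply_eq_sum, Fin.sum_univ_two]
  refine (norm_add_le _ _).trans ?_
  rw [norm_mul, norm_mul, two_mul, add_mul]
  exact add_le_add
    (mul_le_mul (hentry x i 0) (norm_le_pi_norm (u - v) 0) (norm_nonneg _) hL0)
    (mul_le_mul (hentry x i 1) (norm_le_pi_norm (u - v) 1) (norm_nonneg _) hL0)

theorem IsSolution.eq_of_eq {q r : ℝ → ℂ} (hq : IsPotential q) (hr : IsPotential r) {ζ : ℂ}
    {f g : ℝ → Fin 2 → ℂ} (hf : IsSolution q r ζ f) (hg : IsSolution q r ζ g) {x₀ : ℝ}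
    (h : f x₀ = g x₀) : f = g := by
  obtain ⟨K, hK⟩ := exists_lipschitzWith_systemMatrix hq hr ζ
  exact ODE_solution_unique_univ (v := fun x u => systemMatrix q r ζ x *ᵥ u) (s := fun _ => univ)
    (fun x => (hK x).lipschitzOnWith) (fun x => ⟨hf x, mem_univ _⟩)
    (fun x => ⟨hg x, mem_univ _⟩) h

theorem IsSolution.const_smul {q r : ℝ → ℂ} {ζ : ℂ} {f : ℝ → Fin 2 → ℂ}
    (hf : IsSolution q r ζ f) (k : ℂ) : IsSolution q r ζ fun x => k • f x := by
  intro x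
  rw [Matrix.mulVec_smul]
  exact (hf x).const_smul k

/-- The Wronskian of two solutions is constant. -/
theorem IsSolution.wronskian_eq {q r : ℝ → ℂ} {ζ : ℂ} {f g : ℝ → Fin 2 → ℂ}
    (hf : IsSolution q r ζ f) (hg : IsSolution q r ζ g) (x y : ℝ) :
    f x 0 * g x 1 - f x 1 * g x 0 = f y 0 * g y 1 - f y 1 * g y 0 := by
  rw [isSolution_iff] at hf hg
  have hd : ∀ x, HasDerivAt (fun x => f x 0 * g x 1 - f x 1 * g x 0) 0 x := fun x =>
    (((hf x).1.fun_mul (hg x).2).fun_sub ((hf x).2.fun_mul (hg x).1)).congr_deriv (by ring)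
  exact is_const_of_deriv_eq_zero (fun x => (hd x).differentiableAt) (fun x => (hd x).deriv) x y

theorem norm_exp_I_mul_le_one {z : ℂ} (hz : 0 ≤ z.im) {x : ℝ} (hx : 0 ≤ x) :
    ‖Complex.exp (Complex.I * z * x)‖ ≤ 1 := by
  rw [Complex.norm_exp, Complex.re_mul_ofReal, Complex.I_mul_re]
  exact Real.exp_le_one_iff.2 (by nlinarith)

theorem isBigO_exp_I_mul {z : ℂ} (hz : 0 ≤ z.im) :
    (fun x : ℝ => Complex.exp (Complex.I * z * x)) =O[atTop] (fun _ : ℝ => (1 : ℂ)) := by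
  refine IsBigO.of_bound 1 ?_
  filter_upwards [eventually_ge_atTop 0] with x hx
  simpa using norm_exp_I_mul_le_one hz hx

/-- The Wronskian of two candidates is constant and tends to `0`: first components are `o(1)` and
second ones are bounded since `Im ζ² ≥ 0`. So the candidates are proportional, and the asymptotics
of the second component force the factor `1`. -/
theorem IsJostPsi.unique {q r : ℝ → ℂ} (hq : IsPotential q) (hr : IsPotential r) {ζ : ℂ}
    (hζ : 0 ≤ (ζ ^ 2).im) {f g : ℝ → Fin 2 → ℂ} (hf : IsJostPsi q r ζ f)
    (hg : IsJostPsi q r ζ g) : f = g := by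
  have hbig := isBigO_exp_I_mul hζ
  have hW : ∀ x, f x 0 * g x 1 - f x 1 * g x 0 = 0 := by
    intro x
    have h1 := hf.fst.mul_isBigO (hg.snd.isBigO.trans hbig)
    have h2 := (hf.snd.isBigO.trans hbig).mul_isLittleO hg.fst
    have h3 := h1.sub h2
    simp only [mul_one] at h3
    rw [isLittleO_one_iff] at h3
    refine tendsto_nhds_unique ?_ h3
    refine tendsto_const_nhds.congr fun y => ?_
    exact hf.sol.wronskian_eq hg.sol x y
  -- `g x 1` is equivalent to an exponential, which has no zeros.
  have hne : ∀ᶠ x in atTop, g x 1 ≠ 0 := by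
    have := hg.snd.symm.isBigO
    filter_upwards [this.eq_zero_imp] with x hx h0
    exact Complex.exp_ne_zero _ (hx h0)
  obtain ⟨x₀, hx₀⟩ := hne.exists
  have hfg : f = fun x => (f x₀ 1 / g x₀ 1) • g x := by
    refine hf.sol.eq_of_eq hq hr (hg.sol.const_smul _) (x₀ := x₀) ?_
    funext i
    revert i
    rw [Fin.forall_fin_two]
    simp only [Pi.smul_apply, smul_eq_mul]
    constructor
    · field_simp
      linear_combination hW x₀
    · field_simp
  set k := f x₀ 1 / g x₀ 1
  have hk : k = 1 := by
    have h := (isEquivalent_iff_tendsto_one hne).1 (hf.snd.trans hg.snd.symm)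
    refine tendsto_nhds_unique (tendsto_const_nhds.congr' ?_) h
    filter_upwards [hne] with x hx
    rw [Pi.div_apply, hfg]
    simp only [Pi.smul_apply, smul_eq_mul]
    field_simp
  rw [hfg, hk]
  simp

/-! ### Construction of `ψ` from the normalised system. -/

/-- The diagonal potential of the normalised system. -/
noncomputable def diagPotential (q r : ℝ → ℂ) (x : ℝ) : ℂ := -(Complex.I / 2) * (q x * r x)

/-- The first component of `ψ(ζ, x)`, divided by `ζ`, as a function of `λ = ζ²`. -/
noncomputable def psiFst (q r : ℝ → ℂ) (x : ℝ) (z : ℂ) : ℂ :=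
  Complex.exp (Complex.I * z * x) * jostFst (diagPotential q r) q r z x

/-- The second component of `ψ(ζ, x)` as a function of `λ = ζ²`. -/
noncomputable def psiSnd (q r : ℝ → ℂ) (x : ℝ) (z : ℂ) : ℂ :=
  Complex.exp (Complex.I * z * x) * jostSnd (diagPotential q r) q r z x

/-- The Jost solution `ψ`. -/
noncomputable def jostPsi (q r : ℝ → ℂ) (ζ : ℂ) (x : ℝ) : Fin 2 → ℂ :=
  ![ζ * psiFst q r x (ζ ^ 2), psiSnd q r x (ζ ^ 2)]

section psi

variable {q r : ℝ → ℂ}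

theorem isPotential_diagPotential (hq : IsPotential q) (hr : IsPotential r) :
    IsPotential (diagPotential q r) := (hq.mul hr).const_mul _

/-- In the second equation `ζ r` meets the factor `ζ` of the first component and produces the `λ r
u` of the normalised system. -/
theorem isJostPsi_jostPsi (hq : IsPotential q) (hr : IsPotential r) {ζ : ℂ}
    (hζ : 0 ≤ (ζ ^ 2).im) : IsJostPsi q r ζ (jostPsi q r ζ) := by
  have ha := isPotential_diagPotential hq hr
  refine ⟨isSolution_iff.2 fun x => ?_, ?_, ?_⟩
  · have he : HasDerivAt (fun x : ℝ => Complex.exp (Complex.I * ζ ^ 2 * x))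
        (Complex.exp (Complex.I * ζ ^ 2 * x) * (Complex.I * ζ ^ 2)) x := by
      simpa using ((hasDerivAt_id x).ofReal_comp.const_mul (Complex.I * ζ ^ 2)).cexp
    constructor
    · refine ((he.fun_mul (hasDerivAt_jostFst ha hq hr hζ x)).const_mul ζ).congr_deriv ?_
      simp only [jostPsi, psiFst, psiSnd, diagPotential, Matrix.cons_val_zero, Matrix.cons_val_one]
      ring
    · refine (he.fun_mul (hasDerivAt_jostSnd ha hq hr hζ x)).congr_deriv ?_
      simp only [jostPsi, psiFst, psiSnd, diagPotential, Matrix.cons_val_zero, Matrix.cons_val_one]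
      ring
  · have h := ((isBigO_exp_I_mul hζ).mul_isLittleO
      ((isLittleO_one_iff ℂ).2 (tendsto_jostFst ha hq hr hζ))).const_mul_left ζ
    simp only [mul_one] at h
    exact h
  · have h := (IsEquivalent.refl (u := fun x : ℝ => Complex.exp (Complex.I * ζ ^ 2 * x))
      (l := atTop)).mul ((isEquivalent_const_iff_tendsto one_ne_zero).2
        (tendsto_jostSnd ha hq hr hζ))
    refine h.congr_right (Eventually.of_forall fun x => ?_)
    simp

theorem existsUnique_isJostPsi (hq : IsPotential q) (hr : IsPotential r) {ζ : ℂ}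
    (hζ : 0 ≤ (ζ ^ 2).im) : ∃! f, IsJostPsi q r ζ f :=
  ⟨jostPsi q r ζ, isJostPsi_jostPsi hq hr hζ, fun _ hf =>
    hf.unique hq hr hζ (isJostPsi_jostPsi hq hr hζ)⟩

theorem closure_upperPlane_subset : closure upperPlane ⊆ {z | 0 ≤ z.im} :=
  closure_minimal (fun z hz => le_of_lt (show 0 < z.im from hz))
    (isClosed_le continuous_const Complex.continuous_im)

/-- `F` is analytic in `H` and continuous in its closure. -/
def AnalyticContinuous (H : Set ℂ) (F : ℂ → ℂ) : Prop :=
  AnalyticOnNhd ℂ F H ∧ ContinuousOn F (closure H)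

theorem analyticContinuous_psi (hq : IsPotential q) (hr : IsPotential r) (x : ℝ) :
    AnalyticContinuous upperPlane (psiFst q r x) ∧
      AnalyticContinuous upperPlane (psiSnd q r x) := by
  have ha := isPotential_diagPotential hq hr
  have hA := analyticOnNhd_jost ha hq hr x
  have hC := continuousOn_jost ha hq hr x
  have hexp : Differentiable ℂ fun z : ℂ => Complex.exp (Complex.I * z * x) := by fun_prop
  have hexpA : AnalyticOnNhd ℂ (fun z : ℂ => Complex.exp (Complex.I * z * x)) upperPlane :=
    hexp.differentiableOn.analyticOnNhd isOpen_upperPlane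
  exact ⟨⟨hexpA.mul hA.1, hexp.continuous.continuousOn.mul (hC.1.mono closure_upperPlane_subset)⟩,
    ⟨hexpA.mul hA.2, hexp.continuous.continuousOn.mul (hC.2.mono closure_upperPlane_subset)⟩⟩

end psi

/-! ### Symmetries carrying `ψ` to the other Jost solutions. -/

/-- Exchange of the components. -/
def swapComponents (f : ℝ → Fin 2 → ℂ) (x : ℝ) : Fin 2 → ℂ := ![f x 1, f x 0]

/-- Exchange of the components combined with the reflection `x ↦ -x`. -/
def swapReflect (f : ℝ → Fin 2 → ℂ) (x : ℝ) : Fin 2 → ℂ := ![f (-x) 1, f (-x) 0]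

theorem involutive_swapComponents : Function.Involutive swapComponents := by
  intro f
  funext x i
  fin_cases i <;> rfl

theorem involutive_swapReflect : Function.Involutive swapReflect := by
  intro f
  funext x i
  fin_cases i <;> simp [swapReflect]

theorem existsUnique_of_involutive {α : Type*} {e : α → α} (he : Function.Involutive e)
    {P Q : α → Prop} (h : ∀ f, P f ↔ Q (e f)) (hQ : ∃! f, Q f) : ∃! f, P f := by
  obtain ⟨g, hg, hu⟩ := hQ
  refine ⟨e g, (h _).2 (by rwa [he g]), fun f hf => ?_⟩
  rw [← hu _ ((h f).1 hf), he f]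

section symmetry

variable {q r : ℝ → ℂ} {ζ : ℂ} {f : ℝ → Fin 2 → ℂ}

theorem neg_I_mul_sq (ζ : ℂ) : (-Complex.I * ζ) ^ 2 = -ζ ^ 2 := by
  rw [mul_pow, neg_sq, Complex.I_sq, neg_one_mul]

/-- Exchanging components exchanges the diagonal entries, which the new data undo: `ζ²` and `q r`
both change sign. Off the diagonal, `(-iζ)(ir) = ζ r` and likewise for `q`. -/
theorem isSolution_iff_swapComponents :
    IsSolution q r ζ f ↔ IsSolution (fun x => Complex.I * r x) (fun x => Complex.I * q x)
      (-Complex.I * ζ) (swapComponents f) := by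
  rw [isSolution_iff, isSolution_iff]
  refine forall_congr' fun x => and_comm.trans (and_congr ?_ ?_)
  · refine iff_of_eq (congrArg (fun d => HasDerivAt (fun x => f x 1) d x) ?_)
    simp only [swapComponents, Matrix.cons_val_zero, Matrix.cons_val_one, neg_I_mul_sq]
    linear_combination (1 / 2 * Complex.I * q x * r x * f x 1 + ζ * r x * f x 0) * Complex.I_sq
  · refine iff_of_eq (congrArg (fun d => HasDerivAt (fun x => f x 0) d x) ?_)
    simp only [swapComponents, Matrix.cons_val_zero, Matrix.cons_val_one, neg_I_mul_sq]
    linear_combination (-1 / 2 * Complex.I * q x * r x * f x 0 + ζ * q x * f x 1) * Complex.I_sq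

/-- Reflection reverses the sign of the derivative. On the diagonal the exchange of components
restores it, with `ζ` fixed and the product of the potentials merely reflected; off the diagonal the
signs of the new potentials absorb it. -/
theorem IsSolution.swapReflect (hf : IsSolution q r ζ f) :
    IsSolution (fun x => -r (-x)) (fun x => -q (-x)) ζ (swapReflect f) := by
  rw [isSolution_iff] at hf ⊢
  intro x
  have hneg : HasDerivAt (fun x : ℝ => -x) (-1) x := (hasDerivAt_id x).neg
  constructor
  · refine ((hf (-x)).2.scomp x hneg).congr_deriv ?_
    simp only [_root_.swapReflect, Matrix.cons_val_zero, Matrix.cons_val_one, neg_smul, one_smul]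
    ring
  · refine ((hf (-x)).1.scomp x hneg).congr_deriv ?_
    simp only [_root_.swapReflect, Matrix.cons_val_zero, Matrix.cons_val_one, neg_smul, one_smul]
    ring

theorem isSolution_iff_swapReflect :
    IsSolution q r ζ f ↔
      IsSolution (fun x => -r (-x)) (fun x => -q (-x)) ζ (swapReflect f) := by
  refine ⟨IsSolution.swapReflect, fun h => ?_⟩
  -- Applying the symmetry twice returns both the function and the potentials.
  have h' := h.swapReflect
  rw [involutive_swapReflect f] at h'
  simpa only [neg_neg] using h'

theorem exp_neg_I_mul_sq (ζ : ℂ) (x : ℝ) :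
    Complex.exp (Complex.I * (-Complex.I * ζ) ^ 2 * x) =
      Complex.exp (-(Complex.I * ζ ^ 2 * x)) := by
  rw [neg_I_mul_sq]; ring_nf

theorem exp_neg_I_mul_sq_neg (ζ : ℂ) (x : ℝ) :
    Complex.exp (-(Complex.I * (-Complex.I * ζ) ^ 2 * x)) =
      Complex.exp (Complex.I * ζ ^ 2 * x) := by
  rw [neg_I_mul_sq]; ring_nf

theorem isJostPsiBar_iff :
    IsJostPsiBar q r ζ f ↔ IsJostPsi (fun x => Complex.I * r x) (fun x => Complex.I * q x)
      (-Complex.I * ζ) (swapComponents f) := by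
  constructor
  · intro h
    refine ⟨isSolution_iff_swapComponents.1 h.sol, h.snd, ?_⟩
    simp only [exp_neg_I_mul_sq]
    exact h.fst
  · intro h
    have h2 := h.snd
    simp only [exp_neg_I_mul_sq] at h2
    exact ⟨isSolution_iff_swapComponents.2 h.sol, h2, h.fst⟩

theorem isJostPhiBar_iff :
    IsJostPhiBar q r ζ f ↔ IsJostPhi (fun x => Complex.I * r x) (fun x => Complex.I * q x)
      (-Complex.I * ζ) (swapComponents f) := by
  constructor
  · intro h
    refine ⟨isSolution_iff_swapComponents.1 h.sol, ?_, h.fst⟩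
    simp only [exp_neg_I_mul_sq_neg]
    exact h.snd
  · intro h
    have h2 := h.fst
    simp only [exp_neg_I_mul_sq_neg] at h2
    exact ⟨isSolution_iff_swapComponents.2 h.sol, h.snd, h2⟩

theorem isJostPhi_iff :
    IsJostPhi q r ζ f ↔
      IsJostPsi (fun x => -r (-x)) (fun x => -q (-x)) ζ (swapReflect f) := by
  constructor
  · intro h
    refine ⟨isSolution_iff_swapReflect.1 h.sol, h.snd.comp_tendsto tendsto_neg_atTop_atBot, ?_⟩
    have h2 := h.fst.comp_tendsto tendsto_neg_atTop_atBot
    refine h2.congr_right (Eventually.of_forall fun x => ?_)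
    simp
  · intro h
    have h1 := h.fst.comp_tendsto tendsto_neg_atBot_atTop
    have h2 := h.snd.comp_tendsto tendsto_neg_atBot_atTop
    simp only [Function.comp_def, swapReflect, neg_neg, Matrix.cons_val_zero,
      Matrix.cons_val_one, Complex.ofReal_neg, mul_neg] at h1 h2
    exact ⟨isSolution_iff_swapReflect.2 h.sol, h2, h1⟩

end symmetry

/-! ### Existence and uniqueness of the other three solutions. -/

theorem existsUnique_isJostPhi {q r : ℝ → ℂ} (hq : IsPotential q) (hr : IsPotential r) {ζ : ℂ}
    (hζ : 0 ≤ (ζ ^ 2).im) : ∃! f, IsJostPhi q r ζ f :=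
  existsUnique_of_involutive involutive_swapReflect (fun _ => isJostPhi_iff)
    (existsUnique_isJostPsi hr.neg_comp_neg hq.neg_comp_neg hζ)

theorem neg_I_mul_sq_im_nonneg {ζ : ℂ} (hζ : (ζ ^ 2).im ≤ 0) :
    0 ≤ ((-Complex.I * ζ) ^ 2).im := by
  rw [neg_I_mul_sq, Complex.neg_im]
  linarith

theorem existsUnique_isJostPsiBar {q r : ℝ → ℂ} (hq : IsPotential q) (hr : IsPotential r) {ζ : ℂ}
    (hζ : (ζ ^ 2).im ≤ 0) : ∃! f, IsJostPsiBar q r ζ f :=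
  existsUnique_of_involutive involutive_swapComponents (fun _ => isJostPsiBar_iff)
    (existsUnique_isJostPsi (hr.const_mul _) (hq.const_mul _) (neg_I_mul_sq_im_nonneg hζ))

theorem existsUnique_isJostPhiBar {q r : ℝ → ℂ} (hq : IsPotential q) (hr : IsPotential r) {ζ : ℂ}
    (hζ : (ζ ^ 2).im ≤ 0) : ∃! f, IsJostPhiBar q r ζ f :=
  existsUnique_of_involutive involutive_swapComponents (fun _ => isJostPhiBar_iff)
    (existsUnique_isJostPhi (hr.const_mul _) (hq.const_mul _) (neg_I_mul_sq_im_nonneg hζ))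

/-! ### Quadrants under squaring and negation. -/

theorem sq_im_eq (ζ : ℂ) : (ζ ^ 2).im = 2 * (ζ.re * ζ.im) := by
  rw [sq, Complex.mul_im]; ring

theorem sq_mem_upperPlane {ζ : ℂ} (h : ζ ∈ quadrants13) : ζ ^ 2 ∈ upperPlane := by
  show 0 < (ζ ^ 2).im
  rw [sq_im_eq]
  rcases h with ⟨h1, h2⟩ | ⟨h1, h2⟩ <;> nlinarith

theorem sq_mem_lowerPlane {ζ : ℂ} (h : ζ ∈ quadrants24) : ζ ^ 2 ∈ lowerPlane := by
  show (ζ ^ 2).im < 0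
  rw [sq_im_eq]
  rcases h with ⟨h1, h2⟩ | ⟨h1, h2⟩ <;> nlinarith

theorem sq_im_nonneg_of_mem_closure {ζ : ℂ} (h : ζ ∈ closure quadrants13) : 0 ≤ (ζ ^ 2).im :=
  closure_minimal (s := quadrants13) (t := {ζ | 0 ≤ (ζ ^ 2).im})
    (fun ζ h => (show 0 < (ζ ^ 2).im from sq_mem_upperPlane h).le)
    (isClosed_le continuous_const (Complex.continuous_im.comp (continuous_pow 2))) h

theorem sq_im_nonpos_of_mem_closure {ζ : ℂ} (h : ζ ∈ closure quadrants24) : (ζ ^ 2).im ≤ 0 :=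
  closure_minimal (s := quadrants24) (t := {ζ | (ζ ^ 2).im ≤ 0})
    (fun ζ h => (show (ζ ^ 2).im < 0 from sq_mem_lowerPlane h).le)
    (isClosed_le (Complex.continuous_im.comp (continuous_pow 2)) continuous_const) h

theorem isOpen_quadrants13 : IsOpen quadrants13 :=
  ((isOpen_lt continuous_const Complex.continuous_re).inter
    (isOpen_lt continuous_const Complex.continuous_im)).union
  ((isOpen_lt Complex.continuous_re continuous_const).inter
    (isOpen_lt Complex.continuous_im continuous_const))

theorem isOpen_quadrants24 : IsOpen quadrants24 :=
  ((isOpen_lt Complex.continuous_re continuous_const).inter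
    (isOpen_lt continuous_const Complex.continuous_im)).union
  ((isOpen_lt continuous_const Complex.continuous_re).inter
    (isOpen_lt Complex.continuous_im continuous_const))

theorem neg_mem_quadrants13 {ζ : ℂ} (h : ζ ∈ quadrants13) : -ζ ∈ quadrants13 := by
  rcases h with ⟨h1, h2⟩ | ⟨h1, h2⟩
  · right; constructor <;> simpa
  · left; constructor <;> simpa

theorem neg_mem_quadrants24 {ζ : ℂ} (h : ζ ∈ quadrants24) : -ζ ∈ quadrants24 := by
  rcases h with ⟨h1, h2⟩ | ⟨h1, h2⟩
  · right; constructor <;> simpa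
  · left; constructor <;> simpa

/-! ### From the form `(ζ A(ζ²), B(ζ²))` to regularity and parity. -/

section quadrants

variable {Q H : Set ℂ} {g : ℂ → Fin 2 → ℂ} {A B : ℂ → ℂ} {i j : Fin 2}

/-- Consequences of the representation `g i = ζ * A(ζ²)`, `g j = B(ζ²)`. -/
theorem properties_of_square_form (hQ : IsOpen Q) (hsq : ∀ ζ ∈ Q, ζ ^ 2 ∈ H)
    (hneg : ∀ ζ ∈ Q, -ζ ∈ Q) (hij : i ≠ j) (hA : AnalyticContinuous H A)
    (hB : AnalyticContinuous H B) (hgi : ∀ ζ ∈ closure Q, g ζ i = ζ * A (ζ ^ 2))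
    (hgj : ∀ ζ ∈ closure Q, g ζ j = B (ζ ^ 2)) :
    (AnalyticOnNhd ℂ g Q ∧ ContinuousOn g (closure Q)) ∧
      OddIn (closure Q) (fun ζ => g ζ i) ∧ EvenIn (closure Q) (fun ζ => g ζ j) ∧
      AnalyticInSquare (closure Q \ {0}) H (fun ζ => g ζ i / ζ) ∧
      AnalyticInSquare (closure Q) H (fun ζ => g ζ j) := by
  have hneg' : ∀ ζ ∈ closure Q, -ζ ∈ closure Q := fun ζ hζ =>
    map_mem_closure continuous_neg hζ hneg
  have hsq' : MapsTo (fun ζ : ℂ => ζ ^ 2) (closure Q) (closure H) := fun ζ hζ =>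
    map_mem_closure (f := fun ζ : ℂ => ζ ^ 2) (continuous_pow 2) hζ hsq
  have hcover : ∀ k, k = i ∨ k = j := by omega
  have hodd : OddIn (closure Q) (fun ζ => g ζ i) := by
    intro ζ hζ
    simp only
    rw [hgi _ (hneg' ζ hζ), hgi _ hζ, neg_sq, neg_mul]
  have heven : EvenIn (closure Q) (fun ζ => g ζ j) := by
    intro ζ hζ
    simp only
    rw [hgj _ (hneg' ζ hζ), hgj _ hζ, neg_sq]
  -- `A` itself represents the quotient; its continuity on all of `closure H` includes the extension
  -- to `λ = 0`.
  refine ⟨⟨?_, ?_⟩, hodd, heven, ⟨?_, A, ?_, hA⟩, heven, B, hgj, hB⟩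
  · refine analyticOnNhd_pi_iff.2 fun k => ?_
    have hpow : AnalyticOnNhd ℂ (fun ζ : ℂ => ζ ^ 2) Q := analyticOnNhd_id.pow 2
    rcases hcover k with rfl | rfl
    · exact (analyticOnNhd_id.mul (hA.1.comp hpow hsq)).congr hQ
        fun ζ hζ => (hgi ζ (subset_closure hζ)).symm
    · exact (hB.1.comp hpow hsq).congr hQ fun ζ hζ => (hgj ζ (subset_closure hζ)).symm
  · refine continuousOn_pi.2 fun k => ?_
    have hpow : ContinuousOn (fun ζ : ℂ => ζ ^ 2) (closure Q) := (continuous_pow 2).continuousOn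
    rcases hcover k with rfl | rfl
    · exact (continuousOn_id.mul (hA.2.comp hpow hsq')).congr hgi
    · exact (hB.2.comp hpow hsq').congr hgj
  · intro ζ hζ
    have h := hodd ζ hζ.1
    simp only at h ⊢
    rw [h, neg_div_neg_eq]
  · intro ζ hζ
    simp only
    rw [hgi ζ hζ.1, mul_div_cancel_left₀ _ hζ.2]

end quadrants

theorem AnalyticContinuous.comp_neg {F : ℂ → ℂ} (h : AnalyticContinuous upperPlane F) :
    AnalyticContinuous lowerPlane fun z => F (-z) := by
  have hm : MapsTo (fun z : ℂ => -z) lowerPlane upperPlane := fun z hz => by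
    show 0 < (-z).im
    rw [Complex.neg_im]
    exact neg_pos.2 hz
  exact ⟨h.1.comp analyticOnNhd_id.neg hm, h.2.comp continuous_neg.continuousOn
    fun z hz => map_mem_closure continuous_neg hz hm⟩

theorem AnalyticContinuous.const_mul {H : Set ℂ} {F : ℂ → ℂ} (h : AnalyticContinuous H F)
    (k : ℂ) : AnalyticContinuous H fun z => k * F z :=
  ⟨analyticOnNhd_const.mul h.1, continuousOn_const.mul h.2⟩

/-! ### Components of arbitrary Jost solutions, and the theorem. -/

section components

variable {q r : ℝ → ℂ} {ζ : ℂ} {f : ℝ → Fin 2 → ℂ}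

theorem IsJostPsi.apply_eq (hq : IsPotential q) (hr : IsPotential r) (hζ : 0 ≤ (ζ ^ 2).im)
    (h : IsJostPsi q r ζ f) (x : ℝ) :
    f x 0 = ζ * psiFst q r x (ζ ^ 2) ∧ f x 1 = psiSnd q r x (ζ ^ 2) := by
  rw [h.unique hq hr hζ (isJostPsi_jostPsi hq hr hζ)]
  exact ⟨rfl, rfl⟩

theorem IsJostPhi.apply_eq (hq : IsPotential q) (hr : IsPotential r) (hζ : 0 ≤ (ζ ^ 2).im)
    (h : IsJostPhi q r ζ f) (x : ℝ) :
    f x 1 = ζ * psiFst (fun x => -r (-x)) (fun x => -q (-x)) (-x) (ζ ^ 2) ∧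
      f x 0 = psiSnd (fun x => -r (-x)) (fun x => -q (-x)) (-x) (ζ ^ 2) := by
  have h' := (isJostPhi_iff.1 h).apply_eq hr.neg_comp_neg hq.neg_comp_neg hζ (-x)
  simpa only [swapReflect, neg_neg, Matrix.cons_val_zero, Matrix.cons_val_one] using h'

end components

theorem theorem3p4 (q r : 𝓢(ℝ, ℂ)) :
    -- existence (and uniqueness) of the four Jost solutions in the closed quadrants
    ((∀ ζ ∈ closure quadrants13, ∃! f : ℝ → Fin 2 → ℂ, IsJostPsi q r ζ f) ∧
      (∀ ζ ∈ closure quadrants13, ∃! f : ℝ → Fin 2 → ℂ, IsJostPhi q r ζ f) ∧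
      (∀ ζ ∈ closure quadrants24, ∃! f : ℝ → Fin 2 → ℂ, IsJostPsiBar q r ζ f) ∧
      (∀ ζ ∈ closure quadrants24, ∃! f : ℝ → Fin 2 → ℂ, IsJostPhiBar q r ζ f)) ∧
    -- `ψ`, `φ`, `ψb`, `φb` denote those Jost solutions
    ∀ ψ φ ψb φb : ℂ → ℝ → Fin 2 → ℂ,
      (∀ ζ ∈ closure quadrants13, IsJostPsi q r ζ (ψ ζ)) →
      (∀ ζ ∈ closure quadrants13, IsJostPhi q r ζ (φ ζ)) →
      (∀ ζ ∈ closure quadrants24, IsJostPsiBar q r ζ (ψb ζ)) →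
      (∀ ζ ∈ closure quadrants24, IsJostPhiBar q r ζ (φb ζ)) →
      ∀ x : ℝ,
        -- analyticity in the open quadrants, continuity in the closed ones
        ((AnalyticOnNhd ℂ (fun ζ => ψ ζ x) quadrants13 ∧
            ContinuousOn (fun ζ => ψ ζ x) (closure quadrants13)) ∧
          (AnalyticOnNhd ℂ (fun ζ => φ ζ x) quadrants13 ∧
            ContinuousOn (fun ζ => φ ζ x) (closure quadrants13)) ∧
          (AnalyticOnNhd ℂ (fun ζ => ψb ζ x) quadrants24 ∧
            ContinuousOn (fun ζ => ψb ζ x) (closure quadrants24)) ∧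
          (AnalyticOnNhd ℂ (fun ζ => φb ζ x) quadrants24 ∧
            ContinuousOn (fun ζ => φb ζ x) (closure quadrants24))) ∧
        -- parity of the components
        (OddIn (closure quadrants13) (fun ζ => ψ ζ x 0) ∧
          OddIn (closure quadrants24) (fun ζ => ψb ζ x 1) ∧
          OddIn (closure quadrants24) (fun ζ => φb ζ x 0) ∧
          OddIn (closure quadrants13) (fun ζ => φ ζ x 1) ∧
          EvenIn (closure quadrants24) (fun ζ => ψb ζ x 0) ∧
          EvenIn (closure quadrants13) (fun ζ => ψ ζ x 1) ∧
          EvenIn (closure quadrants13) (fun ζ => φ ζ x 0) ∧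
          EvenIn (closure quadrants24) (fun ζ => φb ζ x 1)) ∧
        -- functions of `λ = ζ²`, analytic in the upper half-plane
        (AnalyticInSquare (closure quadrants13 \ {0}) upperPlane (fun ζ => ψ ζ x 0 / ζ) ∧
          AnalyticInSquare (closure quadrants13) upperPlane (fun ζ => ψ ζ x 1) ∧
          AnalyticInSquare (closure quadrants13) upperPlane (fun ζ => φ ζ x 0) ∧
          AnalyticInSquare (closure quadrants13 \ {0}) upperPlane (fun ζ => φ ζ x 1 / ζ)) ∧
        -- functions of `λ = ζ²`, analytic in the lower half-plane
        (AnalyticInSquare (closure quadrants24) lowerPlane (fun ζ => ψb ζ x 0) ∧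
          AnalyticInSquare (closure quadrants24 \ {0}) lowerPlane (fun ζ => ψb ζ x 1 / ζ) ∧
          AnalyticInSquare (closure quadrants24 \ {0}) lowerPlane (fun ζ => φb ζ x 0 / ζ) ∧
          AnalyticInSquare (closure quadrants24) lowerPlane (fun ζ => φb ζ x 1)) := by
  have hq := isPotential_schwartz q
  have hr := isPotential_schwartz r
  refine ⟨⟨fun ζ hζ => existsUnique_isJostPsi hq hr (sq_im_nonneg_of_mem_closure hζ),
    fun ζ hζ => existsUnique_isJostPhi hq hr (sq_im_nonneg_of_mem_closure hζ),
    fun ζ hζ => existsUnique_isJostPsiBar hq hr (sq_im_nonpos_of_mem_closure hζ),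
    fun ζ hζ => existsUnique_isJostPhiBar hq hr (sq_im_nonpos_of_mem_closure hζ)⟩, ?_⟩
  intro ψ φ ψb φb hψ hφ hψb hφb x
  have hψ' := fun ζ hζ =>
    (hψ ζ hζ).apply_eq hq hr (sq_im_nonneg_of_mem_closure hζ) x
  have hφ' := fun ζ hζ =>
    (hφ ζ hζ).apply_eq hq hr (sq_im_nonneg_of_mem_closure hζ) x
  have hψb' := fun ζ hζ => (isJostPsiBar_iff.1 (hψb ζ hζ)).apply_eq (hr.const_mul _)
    (hq.const_mul _) (neg_I_mul_sq_im_nonneg (sq_im_nonpos_of_mem_closure hζ)) x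
  have hφb' := fun ζ hζ => (isJostPhiBar_iff.1 (hφb ζ hζ)).apply_eq (hr.const_mul _)
    (hq.const_mul _) (neg_I_mul_sq_im_nonneg (sq_im_nonpos_of_mem_closure hζ)) x
  simp only [swapComponents, neg_I_mul_sq, Matrix.cons_val_zero, Matrix.cons_val_one]
    at hψb' hφb'
  have hcψ := analyticContinuous_psi hq hr x
  have hcφ := analyticContinuous_psi hr.neg_comp_neg hq.neg_comp_neg (-x)
  -- Since `(-iζ)² = -λ`, the barred solutions are upper half-plane functions evaluated at `-λ`,
  -- hence `comp_neg` below; the factor `-i` comes from the prefactor `-iζ`. For `φb` both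
  -- symmetries are composed.
  have hcψb := analyticContinuous_psi (hr.const_mul Complex.I) (hq.const_mul Complex.I) x
  have hcφb := analyticContinuous_psi (hq.const_mul Complex.I).neg_comp_neg
    (hr.const_mul Complex.I).neg_comp_neg (-x)
  obtain ⟨ψ1, ψ2, ψ3, ψ4, ψ5⟩ := properties_of_square_form (g := fun ζ => ψ ζ x)
    (i := 0) (j := 1) isOpen_quadrants13 (fun _ => sq_mem_upperPlane)
    (fun _ => neg_mem_quadrants13) (by decide) hcψ.1 hcψ.2
    (fun ζ hζ => (hψ' ζ hζ).1) (fun ζ hζ => (hψ' ζ hζ).2)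
  obtain ⟨φ1, φ2, φ3, φ4, φ5⟩ := properties_of_square_form (g := fun ζ => φ ζ x)
    (i := 1) (j := 0) isOpen_quadrants13 (fun _ => sq_mem_upperPlane)
    (fun _ => neg_mem_quadrants13) (by decide) hcφ.1 hcφ.2
    (fun ζ hζ => (hφ' ζ hζ).1) (fun ζ hζ => (hφ' ζ hζ).2)
  obtain ⟨ψb1, ψb2, ψb3, ψb4, ψb5⟩ := properties_of_square_form (g := fun ζ => ψb ζ x)
    (i := 1) (j := 0) isOpen_quadrants24 (fun _ => sq_mem_lowerPlane)
    (fun _ => neg_mem_quadrants24) (by decide) (hcψb.1.comp_neg.const_mul (-Complex.I))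
    hcψb.2.comp_neg (fun ζ hζ => (hψb' ζ hζ).1.trans (by ring)) (fun ζ hζ => (hψb' ζ hζ).2)
  obtain ⟨φb1, φb2, φb3, φb4, φb5⟩ := properties_of_square_form (g := fun ζ => φb ζ x)
    (i := 0) (j := 1) isOpen_quadrants24 (fun _ => sq_mem_lowerPlane)
    (fun _ => neg_mem_quadrants24) (by decide) (hcφb.1.comp_neg.const_mul (-Complex.I))
    hcφb.2.comp_neg (fun ζ hζ => (hφb' ζ hζ).1.trans (by ring)) (fun ζ hζ => (hφb' ζ hζ).2)
  exact ⟨⟨ψ1, φ1, ψb1, φb1⟩, ⟨ψ2, ψb2, φb2, φ2, ψb3, ψ3, φ3, φb3⟩, ⟨ψ4, ψ5, φ5, φ4⟩,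
    ψb5, ψb4, φb4, φb5⟩
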